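/- Let $m\in(0,1)$ and let $\Theta\subset\mathbb R$ be a compact set with (upper) Minkowski dimension $\beta(\Theta)=\limsup_{\delta\to0+}\frac{\log N(\delta)}{\log(1/\delta)}$, where $N(\delta)$ is the least number of closed intervals of radius $\delta$ centred in $\Theta$ that cover $\Theta$ (so $\beta(\Theta)\in[0,1]$ when $\Theta\neq\emptyset$; if the limit exists it is the Minkowski dimension). For $f\in L^2(\mathbb R)$, with $\widehat f(\xi)=\int e^{-ix\xi}f(x)\,dx$ extended to $L^2(\mathbb R)$, write $$e^{it(-\Delta)^{m/2}}f(y)=\lim_{R\to\infty}\frac1{2\pi}\int_{-R}^{R}e^{i(y\xi+t|\xi|^m)}\widehat f(\xi)\,d\xi$$ whenever the limit exists. Suppose $s>\frac12-\frac m4+\frac{m\beta(\Theta)}4$. Then for every $f\in H^s(\mathbb R)$ and almost every $x\in\mathbb R$, $e^{it(-\Delta)^{m/2}}f(y)$ is well defined at all points $(y,t)$ of the lines $y=x-\theta t$, $\theta\in\Theta$, that are sufficiently close to $(x,0)$, and $$\lim_{\substack{(y,t)\to(x,0)\\ y=x-\theta t,\ \theta\in\Theta}}e^{it(-\Delta)^{m/2}}f(y)=f(x).$$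 -/

import Mathlib

open MeasureTheory Filter Topology
open scoped FourierTransform NNReal

noncomputable section

/-- The (upper) Minkowski, or box-counting, dimension
`limsup_{δ → 0+} log N(δ) / log (1/δ)` of a set of real numbers, where `N(δ)` is the least number
of closed intervals of radius `δ` centred in the set that cover it (finite for a bounded set). -/
def minkowskiDim (Θ : Set ℝ) : ℝ :=
  limsup (fun δ : ℝ≥0 =>
    Real.log ((Metric.coveringNumber δ Θ).toNat : ℝ) / Real.log (1 / (δ : ℝ))) (𝓝[>] 0)

/-- Membership of an `L²` function in the inhomogeneous Sobolev space `H^s(ℝ)`. -/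
def InSobolev (s : ℝ) (f : Lp ℂ 2 (volume : Measure ℝ)) : Prop :=
  TemperedDistribution.MemSobolev s 2 (f : TemperedDistribution ℝ ℂ)

/-- The truncated Fourier integral of `e^{it(-Δ)^{m/2}} f` at the point `y`, over frequencies
`|ξ| ≤ R`. Mathlib's Fourier transform has kernel `e^{-2πi xξ}`, so that `(-Δ)^{m/2}` has
the symbol `|2πξ|^m`. -/
def truncatedEvolution (m : ℝ) (f : Lp ℂ 2 (volume : Measure ℝ)) (R y t : ℝ) : ℂ :=
  ∫ ξ in Set.Icc (-R) R,
    Complex.exp (Complex.I * ((2 * Real.pi * y * ξ + t * |2 * Real.pi * ξ| ^ m : ℝ) : ℂ)) *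
      (𝓕 f : Lp ℂ 2 (volume : Measure ℝ)) ξ

/-- The Fourier integral defining `e^{it(-Δ)^{m/2}} f (y)` converges. -/
def EvolutionConverges (m : ℝ) (f : Lp ℂ 2 (volume : Measure ℝ)) (y t : ℝ) : Prop :=
  ∃ z : ℂ, Tendsto (fun R : ℝ => truncatedEvolution m f R y t) atTop (𝓝 z)

/-- The value `e^{it(-Δ)^{m/2}} f (y)`, as the limit of the truncated Fourier integrals
(meaningful when `EvolutionConverges m f y t`). -/
def evolution (m : ℝ) (f : Lp ℂ 2 (volume : Measure ℝ)) (y t : ℝ) : ℂ :=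
  limUnder atTop (fun R : ℝ => truncatedEvolution m f R y t)

/-- The points `(y, t)` of the lines `y = x - θ t` with `θ ∈ Θ`. -/
def linesThrough (Θ : Set ℝ) (x : ℝ) : Set (ℝ × ℝ) :=
  {p | ∃ θ ∈ Θ, p.1 = x - θ * p.2}

end

/-! Cut frequency space into $[-1,1]$ and the dyadic shells $\lambda<|\xi|\le2\lambda$. It is enough
that, for almost every $x$, the pieces of the evolution are bounded by a summable sequence,
uniformly over slopes $\theta\in\Theta$, times $|t|\le1$ and cutoffs $R$
(`ae_exists_summable_bound`). Dominated convergence for series then gives both the limit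
$R\to\infty$ and the limit $(y,t)\to(x,0)$, each piece being continuous in $(y,t)$. The value at
$(x,0)$ is $f(x)$ because the truncated Fourier integrals at time zero converge to $f$ in $L^2$.

The bound for one shell is a maximal estimate. The supremum is linearized by a measurable choice of
parameters, and `integral_norm_sq_le_of_kernel` reduces the $L^2$ bound to integrating the $TT^*$
kernel. When all slopes lie within $\lambda^{-m/2}$ of one number, the kernel is trivially
$O(\lambda)$ for $|x-x'|\lesssim\lambda^{-m/2}$, and otherwise $O(\lambda^{1-m/2}|x-x'|^{-1/2})$ by
van der Corput (`norm_kernel_le`). Both parts integrate to $O(\lambda^{1-m/2})$, which is why slopes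
are grouped at the scale $\lambda^{-m/2}$.

For $\beta>\beta(\Theta)$, $O(\lambda^{m\beta/2})$ such groups cover $\Theta$, and Sobolev
regularity contributes $\lambda^{-2s}$. The squared $L^2$ norm of the maximal function is thus
$O(\lambda^{1-m/2+m\beta/2-2s})$, which decays geometrically along the shells for $\beta$ close to
$\beta(\Theta)$ exactly under the hypothesis on $s$. -/

/-! ### Van der Corput's lemma. -/

/-- First derivative test of van der Corput for a phase with monotone derivative. -/
theorem norm_integral_exp_le_of_le_abs_deriv {φ φ' φ'' : ℝ → ℝ} {a b μ : ℝ} (hab : a ≤ b)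
    (hμ : 0 < μ) (hφ : ∀ x ∈ Set.Icc a b, HasDerivAt φ (φ' x) x)
    (hφ' : ∀ x ∈ Set.Icc a b, HasDerivAt φ' (φ'' x) x)
    (hc : ContinuousOn φ'' (Set.Icc a b)) (hnn : ∀ x ∈ Set.Icc a b, 0 ≤ φ'' x)
    (hl : ∀ x ∈ Set.Icc a b, μ ≤ |φ' x|) :
    ‖∫ x in a..b, Complex.exp (Complex.I * (φ x : ℂ))‖ ≤ 4 / μ := by
  have hne : ∀ x ∈ Set.Icc a b, φ' x ≠ 0 := fun x hx h => by
    have := hl x hx; rw [h, abs_zero] at this; linarith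
  have hcφ' : ContinuousOn φ' (Set.Icc a b) := fun x hx => (hφ' x hx).continuousAt.continuousWithinAt
  have hcφ : ContinuousOn φ (Set.Icc a b) := fun x hx => (hφ x hx).continuousAt.continuousWithinAt
  have hU : Set.uIcc a b = Set.Icc a b := Set.uIcc_of_le hab
  set w : ℝ → ℝ := fun x => (φ' x)⁻¹ with hw
  set w' : ℝ → ℝ := fun x => -φ'' x / (φ' x) ^ 2 with hw'
  have dw : ∀ x ∈ Set.uIcc a b, HasDerivAt w (w' x) x := fun x hx => by
    rw [hU] at hx
    exact (hφ' x hx).inv (hne x hx)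
  have cw' : ContinuousOn w' (Set.Icc a b) :=
    hc.neg.div (hcφ'.pow 2) fun x hx => pow_ne_zero 2 (hne x hx)
  set v : ℝ → ℂ := fun x => Complex.exp (Complex.I * (φ x : ℂ)) with hv
  set v' : ℝ → ℂ := fun x => Complex.exp (Complex.I * (φ x : ℂ)) * (Complex.I * (φ' x : ℂ)) with hv'
  have dv : ∀ x ∈ Set.uIcc a b, HasDerivAt v (v' x) x := fun x hx => by
    rw [hU] at hx
    exact (((hφ x hx).ofReal_comp).const_mul Complex.I).cexp
  have cv : ContinuousOn v (Set.Icc a b) := by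
    apply Complex.continuous_exp.comp_continuousOn
    exact continuousOn_const.mul (Complex.continuous_ofReal.comp_continuousOn hcφ)
  have cv' : ContinuousOn v' (Set.Icc a b) :=
    cv.mul (continuousOn_const.mul (Complex.continuous_ofReal.comp_continuousOn hcφ'))
  have iw' : IntervalIntegrable w' volume a b := (hU ▸ cw').intervalIntegrable
  have key := intervalIntegral.integral_mul_deriv_eq_deriv_mul
    (u := fun x => (w x : ℂ)) (u' := fun x => (w' x : ℂ)) (fun x hx => (dw x hx).ofReal_comp) dv
    (hU ▸ Complex.continuous_ofReal.comp_continuousOn cw').intervalIntegrable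
    (hU ▸ cv').intervalIntegrable
  have e1 : ∫ x in a..b, (w x : ℂ) * v' x = Complex.I * ∫ x in a..b, v x := by
    rw [← intervalIntegral.integral_const_mul]
    apply intervalIntegral.integral_congr
    intro x hx
    rw [hU] at hx
    have h0 : (φ' x : ℂ) ≠ 0 := by exact_mod_cast hne x hx
    simp only [hw, hv', hv, Complex.ofReal_inv]
    field_simp
  have nv : ∀ x, ‖v x‖ = 1 := fun x => by
    simp only [hv, mul_comm Complex.I, Complex.norm_exp_ofReal_mul_I]
  have bw : ∀ x ∈ Set.Icc a b, |w x| ≤ 1 / μ := fun x hx => by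
    simp only [hw, abs_inv]
    rw [← one_div]
    exact one_div_le_one_div_of_le hμ (hl x hx)
  have hA := bw a ⟨le_rfl, hab⟩
  have hB := bw b ⟨hab, le_rfl⟩
  -- The derivative of $1/\varphi'$ has constant sign, so its total variation telescopes to boundary
  -- values.
  have e2 : ‖∫ x in a..b, (w' x : ℂ) * v x‖ ≤ 2 / μ := by
    calc ‖∫ x in a..b, (w' x : ℂ) * v x‖ ≤ ∫ x in a..b, -w' x := by
          apply intervalIntegral.norm_integral_le_of_norm_le hab _ iw'.neg
          filter_upwards with x hx
          have h1 := hnn x ⟨hx.1.le, hx.2⟩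
          have h2 : w' x ≤ 0 := by
            simp only [hw', neg_div]
            exact neg_nonpos.2 (by positivity)
          rw [norm_mul, nv, mul_one, Complex.norm_real, Real.norm_eq_abs, abs_of_nonpos h2]
          exact le_rfl
      _ = w a - w b := by
          rw [intervalIntegral.integral_neg, intervalIntegral.integral_eq_sub_of_hasDerivAt dw iw']
          ring
      _ ≤ 2 / μ := by
          have h1 := abs_le.1 hA
          have h2 := abs_le.1 hB
          have : (2 : ℝ) / μ = 1 / μ + 1 / μ := by ring
          linarith
  have e3 : ‖∫ x in a..b, v x‖ = ‖(w b : ℂ) * v b - (w a : ℂ) * v a - ∫ x in a..b, (w' x : ℂ) * v x‖ := by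
    rw [← key, e1, norm_mul, Complex.norm_I, one_mul]
  rw [e3]
  have n1 : ‖(w b : ℂ) * v b‖ ≤ 1 / μ := by rw [norm_mul, nv, mul_one, Complex.norm_real]; exact hB
  have n2 : ‖(w a : ℂ) * v a‖ ≤ 1 / μ := by rw [norm_mul, nv, mul_one, Complex.norm_real]; exact hA
  have : (4 : ℝ) / μ = 1 / μ + 1 / μ + 2 / μ := by ring
  have h3 := norm_sub_le ((w b : ℂ) * v b - (w a : ℂ) * v a) (∫ x in a..b, (w' x : ℂ) * v x)
  have h4 := norm_sub_le ((w b : ℂ) * v b) ((w a : ℂ) * v a)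
  linarith

theorem norm_integral_exp_le_sub {φ : ℝ → ℝ} {a b : ℝ} (hab : a ≤ b) :
    ‖∫ x in a..b, Complex.exp (Complex.I * (φ x : ℂ))‖ ≤ b - a := by
  have := intervalIntegral.norm_integral_le_of_norm_le_const (a := a) (b := b) (C := 1)
    (f := fun x => Complex.exp (Complex.I * (φ x : ℂ)))
    (fun x _ => by rw [mul_comm, Complex.norm_exp_ofReal_mul_I])
  rwa [one_mul, abs_of_nonneg (by linarith)] at this

/-- Second derivative test when the derivative is nonnegative at the left end. -/
theorem norm_integral_exp_le_of_deriv_left_nonneg {φ φ' φ'' : ℝ → ℝ} {a b ν η : ℝ} (hab : a ≤ b)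
    (hν : 0 < ν) (hη : 0 < η) (hφ : ∀ x ∈ Set.Icc a b, HasDerivAt φ (φ' x) x)
    (hφ' : ∀ x ∈ Set.Icc a b, HasDerivAt φ' (φ'' x) x)
    (hc : ContinuousOn φ'' (Set.Icc a b)) (hnn : ∀ x ∈ Set.Icc a b, ν ≤ φ'' x)
    (h0 : 0 ≤ φ' a) :
    ‖∫ x in a..b, Complex.exp (Complex.I * (φ x : ℂ))‖ ≤ η + 4 / (ν * η) := by
  have hpos : 0 < 4 / (ν * η) := by positivity
  -- The initial stretch of length $\eta$ is estimated trivially; beyond it the mean value theorem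
  -- gives $\varphi'\ge\nu\eta$ and the first derivative test applies.
  rcases le_total b (a + η) with h | h
  · exact (norm_integral_exp_le_sub hab).trans (by linarith)
  have hcφ : ContinuousOn φ (Set.Icc a b) := fun x hx => (hφ x hx).continuousAt.continuousWithinAt
  have cv : ContinuousOn (fun x => Complex.exp (Complex.I * (φ x : ℂ))) (Set.Icc a b) := by
    apply Complex.continuous_exp.comp_continuousOn
    exact continuousOn_const.mul (Complex.continuous_ofReal.comp_continuousOn hcφ)
  have s1 : Set.Icc a (a + η) ⊆ Set.Icc a b := Set.Icc_subset_Icc_right h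
  have s2 : Set.Icc (a + η) b ⊆ Set.Icc a b := Set.Icc_subset_Icc_left (by linarith)
  rw [← intervalIntegral.integral_add_adjacent_intervals (b := a + η)
    (cv.mono s1 |>.intervalIntegrable_of_Icc (by linarith))
    (cv.mono s2 |>.intervalIntegrable_of_Icc h)]
  refine (norm_add_le _ _).trans (add_le_add ?_ ?_)
  · exact (norm_integral_exp_le_sub (by linarith)).trans (by linarith)
  · refine norm_integral_exp_le_of_le_abs_deriv h (by positivity) (fun x hx => hφ x (s2 hx))
      (fun x hx => hφ' x (s2 hx)) (hc.mono s2) (fun x hx => hν.le.trans (hnn x (s2 hx))) ?_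
    intro x hx
    have hx' := s2 hx
    have hax : a < x := by linarith [hx.1]
    obtain ⟨c, hc1, hc2⟩ := exists_hasDerivAt_eq_slope φ' φ'' hax
      (fun y hy => (hφ' y ⟨hy.1, hy.2.trans hx'.2⟩).continuousAt.continuousWithinAt)
      (fun y hy => hφ' y ⟨hy.1.le, hy.2.le.trans hx'.2⟩)
    have h1 := hnn c ⟨hc1.1.le, hc1.2.le.trans hx'.2⟩
    rw [hc2, le_div_iff₀ (by linarith)] at h1
    have h2 : ν * η ≤ ν * (x - a) := mul_le_mul_of_nonneg_left (by linarith [hx.1]) hν.le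
    exact le_trans (by linarith) (le_abs_self _)

/-- Second derivative test when the derivative is nonpositive at the right end. -/
theorem norm_integral_exp_le_of_deriv_right_nonpos {φ φ' φ'' : ℝ → ℝ} {a b ν η : ℝ} (hab : a ≤ b)
    (hν : 0 < ν) (hη : 0 < η) (hφ : ∀ x ∈ Set.Icc a b, HasDerivAt φ (φ' x) x)
    (hφ' : ∀ x ∈ Set.Icc a b, HasDerivAt φ' (φ'' x) x)
    (hc : ContinuousOn φ'' (Set.Icc a b)) (hnn : ∀ x ∈ Set.Icc a b, ν ≤ φ'' x)
    (h0 : φ' b ≤ 0) :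
    ‖∫ x in a..b, Complex.exp (Complex.I * (φ x : ℂ))‖ ≤ η + 4 / (ν * η) := by
  have hm : ∀ x ∈ Set.Icc (-b) (-a), -x ∈ Set.Icc a b := fun x hx =>
    ⟨by linarith [hx.2], by linarith [hx.1]⟩
  have := norm_integral_exp_le_of_deriv_left_nonneg (φ := fun x => φ (-x)) (φ' := fun x => -φ' (-x))
    (φ'' := fun x => φ'' (-x)) (neg_le_neg hab) hν hη
    (fun x hx => by
      have h := (hφ (-x) (hm x hx)).comp x (hasDerivAt_neg x)
      rwa [mul_neg_one] at h)
    (fun x hx => by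
      have h := ((hφ' (-x) (hm x hx)).comp x (hasDerivAt_neg x)).neg
      rwa [mul_neg_one, neg_neg] at h)
    (hc.comp continuousOn_id.neg hm)
    (fun x hx => hnn _ (hm x hx)) (by simpa using h0)
  rwa [intervalIntegral.integral_comp_neg (fun x => Complex.exp (Complex.I * (φ x : ℂ))),
    neg_neg, neg_neg] at this

/-- Second derivative test of van der Corput. -/
theorem norm_integral_exp_le_of_le_deriv2 {φ φ' φ'' : ℝ → ℝ} {a b ν : ℝ} (hab : a ≤ b)
    (hν : 0 < ν) (hφ : ∀ x ∈ Set.Icc a b, HasDerivAt φ (φ' x) x)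
    (hφ' : ∀ x ∈ Set.Icc a b, HasDerivAt φ' (φ'' x) x)
    (hc : ContinuousOn φ'' (Set.Icc a b)) (hnn : ∀ x ∈ Set.Icc a b, ν ≤ φ'' x) :
    ‖∫ x in a..b, Complex.exp (Complex.I * (φ x : ℂ))‖ ≤ 10 / √ν := by
  have hs : 0 < √ν := Real.sqrt_pos.2 hν
  -- The choice $\eta=\nu^{-1/2}$ balances the two terms; splitting at a zero of $\varphi'$ doubles
  -- $5/\sqrt\nu$.
  have he : 1 / √ν + 4 / (ν * (1 / √ν)) = 5 / √ν := by
    have : ν * (1 / √ν) = √ν := by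
      rw [mul_one_div, Real.div_sqrt]
    rw [this]; ring
  have h5 : 5 / √ν ≤ 10 / √ν := by gcongr; norm_num
  have hη : 0 < 1 / √ν := by positivity
  rcases le_total 0 (φ' a) with h | h
  · have := norm_integral_exp_le_of_deriv_left_nonneg hab hν hη hφ hφ' hc hnn h
    linarith
  rcases le_total (φ' b) 0 with h' | h'
  · have := norm_integral_exp_le_of_deriv_right_nonpos hab hν hη hφ hφ' hc hnn h'
    linarith
  have hcφ : ContinuousOn φ (Set.Icc a b) := fun x hx => (hφ x hx).continuousAt.continuousWithinAt
  have cv : ContinuousOn (fun x => Complex.exp (Complex.I * (φ x : ℂ))) (Set.Icc a b) := by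
    apply Complex.continuous_exp.comp_continuousOn
    exact continuousOn_const.mul (Complex.continuous_ofReal.comp_continuousOn hcφ)
  obtain ⟨c, hcm, hc0⟩ := intermediate_value_Icc hab
    (fun x hx => (hφ' x hx).continuousAt.continuousWithinAt : ContinuousOn φ' _) ⟨h, h'⟩
  have s1 : Set.Icc a c ⊆ Set.Icc a b := Set.Icc_subset_Icc_right hcm.2
  have s2 : Set.Icc c b ⊆ Set.Icc a b := Set.Icc_subset_Icc_left hcm.1
  rw [← intervalIntegral.integral_add_adjacent_intervals
    (cv.mono s1 |>.intervalIntegrable_of_Icc hcm.1)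
    (cv.mono s2 |>.intervalIntegrable_of_Icc hcm.2)]
  have k1 := norm_integral_exp_le_of_deriv_right_nonpos hcm.1 hν hη (fun x hx => hφ x (s1 hx))
    (fun x hx => hφ' x (s1 hx)) (hc.mono s1) (fun x hx => hnn x (s1 hx)) hc0.le
  have k2 := norm_integral_exp_le_of_deriv_left_nonneg hcm.2 hν hη (fun x hx => hφ x (s2 hx))
    (fun x hx => hφ' x (s2 hx)) (hc.mono s2) (fun x hx => hnn x (s2 hx)) hc0.ge
  refine (norm_add_le _ _).trans ?_
  have : 10 / √ν = 5 / √ν + 5 / √ν := by ring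
  linarith

theorem norm_integral_exp_neg (φ : ℝ → ℝ) (a b : ℝ) :
    ‖∫ x in a..b, Complex.exp (Complex.I * ((-φ x : ℝ) : ℂ))‖ =
      ‖∫ x in a..b, Complex.exp (Complex.I * (φ x : ℂ))‖ := by
  rw [intervalIntegral.norm_intervalIntegral_eq, intervalIntegral.norm_intervalIntegral_eq,
    ← Complex.norm_conj, ← integral_conj]
  congr 2
  ext x
  simp [← Complex.exp_conj]

/-! ### Oscillatory integrals with phase $c\xi+b\xi^m$. -/

section PowerPhase

variable {m lam α β : ℝ}

theorem hasDerivAt_powerPhase (m c b : ℝ) {x : ℝ} (hx : 0 < x) :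
    HasDerivAt (fun ξ => c * ξ + b * ξ ^ m) (c + b * (m * x ^ (m - 1))) x := by
  have h := ((hasDerivAt_id x).const_mul c).add
    ((Real.hasDerivAt_rpow_const (p := m) (Or.inl hx.ne')).const_mul b)
  rw [mul_one] at h
  exact h

theorem hasDerivAt_powerPhase_deriv (m c b : ℝ) {x : ℝ} (hx : 0 < x) :
    HasDerivAt (fun ξ => c + b * (m * ξ ^ (m - 1))) (b * (m * ((m - 1) * x ^ (m - 2)))) x := by
  have h := (((Real.hasDerivAt_rpow_const (p := m - 1) (Or.inl hx.ne')).const_mul m).const_mul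
    b).const_add c
  have e : m - 1 - 1 = m - 2 := by ring
  rwa [e] at h

theorem continuousOn_powerPhase_deriv2 (m b : ℝ) {s : Set ℝ} (hs : ∀ x ∈ s, 0 < x) :
    ContinuousOn (fun x : ℝ => b * (m * ((m - 1) * x ^ (m - 2)))) s := by
  have : ContinuousOn (fun x : ℝ => x ^ (m - 2)) s :=
    continuousOn_id.rpow_const fun x hx => Or.inl (hs x hx).ne'
  exact continuousOn_const.mul (continuousOn_const.mul (continuousOn_const.mul this))

/-- Conjugation symmetry, which reduces the estimates for power phases to `b ≤ 0`. -/
theorem norm_integral_powerPhase_neg (m c b a' b' : ℝ) :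
    ‖∫ ξ in a'..b', Complex.exp (Complex.I * ((-c * ξ + -b * ξ ^ m : ℝ) : ℂ))‖ =
      ‖∫ ξ in a'..b', Complex.exp (Complex.I * ((c * ξ + b * ξ ^ m : ℝ) : ℂ))‖ := by
  rw [← norm_integral_exp_neg (fun ξ => c * ξ + b * ξ ^ m)]
  congr 1
  apply intervalIntegral.integral_congr
  intro x _
  simp only
  congr 3
  ring

/-- For $\xi\ge1$ and $m<1$ the nonlinear part $bm\xi^{m-1}$ of the phase derivative is at most
$|b|$, so the linear part dominates. Taking $b\le0$ makes the second derivative nonnegative. -/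
theorem norm_integral_powerPhase_le_of_lt (hm0 : 0 < m) (hm1 : m < 1) (hα : 1 ≤ α) (hαβ : α ≤ β)
    {c b μ : ℝ} (hμ : 0 < μ) (hcb : |b| + μ ≤ |c|) :
    ‖∫ ξ in α..β, Complex.exp (Complex.I * ((c * ξ + b * ξ ^ m : ℝ) : ℂ))‖ ≤ 4 / μ := by
  wlog hb : b ≤ 0 generalizing c b
  · rw [← norm_integral_powerPhase_neg]
    exact this (by simpa using hcb) (by linarith)
  have hp : ∀ x ∈ Set.Icc α β, 0 < x := fun x hx => by linarith [hx.1]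
  refine norm_integral_exp_le_of_le_abs_deriv hαβ hμ (fun x hx => hasDerivAt_powerPhase m c b (hp x hx))
    (fun x hx => hasDerivAt_powerPhase_deriv m c b (hp x hx))
    (continuousOn_powerPhase_deriv2 m b hp) (fun x hx => ?_) (fun x hx => ?_)
  · have h1 : 0 ≤ x ^ (m - 2) := Real.rpow_nonneg (hp x hx).le _
    have h2 : (m - 1) * x ^ (m - 2) ≤ 0 := mul_nonpos_of_nonpos_of_nonneg (by linarith) h1
    exact mul_nonneg_of_nonpos_of_nonpos hb (mul_nonpos_of_nonneg_of_nonpos hm0.le h2)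
  · have h1 : x ^ (m - 1) ≤ 1 := Real.rpow_le_one_of_one_le_of_nonpos (by linarith [hx.1]) (by linarith)
    have h0 : 0 ≤ x ^ (m - 1) := Real.rpow_nonneg (hp x hx).le _
    have h2 : |m * x ^ (m - 1)| ≤ 1 := by
      rw [abs_of_nonneg (by positivity)]
      exact mul_le_one₀ hm1.le h0 h1
    have h3 : |b * (m * x ^ (m - 1))| ≤ |b| := by
      rw [abs_mul]; exact mul_le_of_le_one_right (abs_nonneg _) h2
    have h4 := abs_sub_abs_le_abs_sub c (-(b * (m * x ^ (m - 1))))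
    rw [abs_neg, sub_neg_eq_add] at h4
    linarith

/-- The second derivative does not see $c$, and its modulus decreases in $\xi$, so its value at
$2\lambda$ is a lower bound on the shell. -/
theorem norm_integral_powerPhase_le_rpow (hm0 : 0 < m) (hm1 : m < 1) (hlam : 0 < lam)
    (hα : lam ≤ α) (hαβ : α ≤ β) (hβ : β ≤ 2 * lam) {c b : ℝ} (hb0 : b ≠ 0) :
    ‖∫ ξ in α..β, Complex.exp (Complex.I * ((c * ξ + b * ξ ^ m : ℝ) : ℂ))‖ ≤
      10 / √(|b| * (m * ((1 - m) * (2 * lam) ^ (m - 2)))) := by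
  wlog hb : b < 0 generalizing c b
  · rw [← norm_integral_powerPhase_neg, ← abs_neg b]
    refine this (neg_ne_zero.2 hb0) ?_
    have : 0 < b := lt_of_le_of_ne (not_lt.1 hb) hb0.symm
    linarith
  have hp : ∀ x ∈ Set.Icc α β, 0 < x := fun x hx => by linarith [hx.1]
  have h1m : 0 < 1 - m := by linarith
  refine norm_integral_exp_le_of_le_deriv2 hαβ (by positivity)
    (fun x hx => hasDerivAt_powerPhase m c b (hp x hx))
    (fun x hx => hasDerivAt_powerPhase_deriv m c b (hp x hx))
    (continuousOn_powerPhase_deriv2 m b hp) (fun x hx => ?_)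
  have h1 : (2 * lam) ^ (m - 2) ≤ x ^ (m - 2) :=
    Real.rpow_le_rpow_of_nonpos (hp x hx) (hx.2.trans hβ) (by linarith)
  rw [abs_of_neg hb]
  have : b * (m * ((m - 1) * x ^ (m - 2))) = -b * (m * ((1 - m) * x ^ (m - 2))) := by ring
  rw [this]
  have : 0 < -b := by linarith
  gcongr

end PowerPhase

/-! ### The $TT^*$ method, Schur's test and linearization of suprema. -/

section TTStar

open scoped ComplexConjugate

variable {X Y : Type*} [MeasurableSpace X] [MeasurableSpace Y] {μ : Measure X} {ν : Measure Y}
  [IsFiniteMeasure μ] [IsFiniteMeasure ν]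

theorem integral_mul_kernel_swap {a : X → Y → ℂ} (ha : Measurable (Function.uncurry a))
    (hb : ∀ x y, ‖a x y‖ ≤ 1) {P : Y → ℂ} {Q : X → ℂ} (hP : Integrable P ν) (hQ : Integrable Q μ) :
    ∫ x, (∫ y, a x y * P y ∂ν) * conj (Q x) ∂μ = ∫ y, P y * conj (∫ x, conj (a x y) * Q x ∂μ) ∂ν := by
  have hQ' : Integrable (fun x => conj (Q x)) μ := by
    exact Complex.conjCLE.integrable_comp_iff.2 hQ
  have hint : Integrable (Function.uncurry fun x y => a x y * (conj (Q x) * P y)) (μ.prod ν) :=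
    (hQ'.mul_prod hP).bdd_mul (c := 1) ha.aestronglyMeasurable (Eventually.of_forall fun z => hb z.1 z.2)
  calc ∫ x, (∫ y, a x y * P y ∂ν) * conj (Q x) ∂μ
      = ∫ x, ∫ y, a x y * (conj (Q x) * P y) ∂ν ∂μ := by
        congr 1; ext x
        rw [← integral_mul_const]
        congr 1; ext y; ring
    _ = ∫ y, ∫ x, a x y * (conj (Q x) * P y) ∂μ ∂ν := integral_integral_swap hint
    _ = _ := by
        congr 1; ext y
        rw [← integral_conj, ← integral_const_mul]
        congr 1; ext x
        simp; ring

/-- The `TT*` argument combined with Schur's test. -/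
theorem integral_norm_sq_le_of_kernel {a : X → Y → ℂ} (ha : Measurable (Function.uncurry a))
    (hb : ∀ x y, ‖a x y‖ ≤ 1) {F : Y → ℂ} (hF : MemLp F 2 ν) {A : ℝ} (hA : 0 < A)
    (hK : ∀ x, ∫ x', ‖∫ y, a x y * conj (a x' y) ∂ν‖ ∂μ ≤ A) :
    ∫ x, ‖∫ y, a x y * F y ∂ν‖ ^ 2 ∂μ ≤ A * ∫ y, ‖F y‖ ^ 2 ∂ν := by
  have hFi : Integrable F ν := hF.integrable (by norm_num)
  set G : X → ℂ := fun x => ∫ y, a x y * F y ∂ν with hG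
  have mconj : Measurable (conj : ℂ → ℂ) := Complex.continuous_conj.measurable
  have mG : AEStronglyMeasurable G μ := by
    have : AEStronglyMeasurable (Function.uncurry fun x y => a x y * F y) (μ.prod ν) :=
      ha.aestronglyMeasurable.mul hFi.1.comp_snd
    exact this.integral_prod_right'
  have bG : ∀ x, ‖G x‖ ≤ ∫ y, ‖F y‖ ∂ν := fun x => by
    refine norm_integral_le_of_norm_le hFi.norm (Eventually.of_forall fun y => ?_)
    rw [norm_mul]
    exact mul_le_of_le_one_left (norm_nonneg _) (hb x y)
  have iG : Integrable G μ := Integrable.of_bound mG _ (Eventually.of_forall bG)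
  set M := ∫ y, ‖F y‖ ∂ν
  set H : Y → ℂ := fun y => ∫ x, conj (a x y) * G x ∂μ with hH
  have mH : AEStronglyMeasurable H ν := by
    have : AEStronglyMeasurable (Function.uncurry fun y x => conj (a x y) * G x) (ν.prod μ) :=
      (mconj.comp (ha.comp measurable_swap)).aestronglyMeasurable.mul iG.1.comp_snd
    exact this.integral_prod_right'
  have bH : ∀ y, ‖H y‖ ≤ ∫ x, ‖G x‖ ∂μ := fun y => by
    refine norm_integral_le_of_norm_le iG.norm (Eventually.of_forall fun x => ?_)
    rw [norm_mul, Complex.norm_conj]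
    exact mul_le_of_le_one_left (norm_nonneg _) (hb x y)
  have iH : Integrable H ν := Integrable.of_bound mH _ (Eventually.of_forall bH)
  have lH : MemLp H 2 ν := MemLp.of_bound mH _ (Eventually.of_forall bH)
  have lG : MemLp G 2 μ := MemLp.of_bound mG _ (Eventually.of_forall bG)
  set K : X → X → ℂ := fun x x' => ∫ y, a x y * conj (a x' y) ∂ν with hKdef
  have mK : Measurable (Function.uncurry K) := by
    have : Measurable (Function.uncurry fun (z : X × X) y => a z.1 y * conj (a z.2 y)) := by
      apply Measurable.mul
      · exact ha.comp (by fun_prop : Measurable fun z : (X × X) × Y => (z.1.1, z.2))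
      · exact mconj.comp (ha.comp (by fun_prop : Measurable fun z : (X × X) × Y => (z.1.2, z.2)))
    exact this.stronglyMeasurable.integral_prod_right'.measurable
  have bK : ∀ x x', ‖K x x'‖ ≤ ν.real Set.univ := fun x x' => by
    have := norm_integral_le_of_norm_le_const (μ := ν) (f := fun y => a x y * conj (a x' y)) (C := 1)
      (Eventually.of_forall fun y => by
        rw [norm_mul, Complex.norm_conj]
        exact mul_le_one₀ (hb x y) (norm_nonneg _) (hb x' y))
    simpa using this
  have sK : ∀ x x', ‖K x x'‖ = ‖K x' x‖ := fun x x' => by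
    rw [← Complex.norm_conj, hKdef]
    simp only
    rw [← integral_conj]
    congr 2; ext y; simp [mul_comm]
  -- the two pairings
  have p1 : ∫ y, F y * conj (H y) ∂ν = ((∫ x, ‖G x‖ ^ 2 ∂μ : ℝ) : ℂ) := by
    rw [← integral_mul_kernel_swap ha hb hFi iG, ← integral_complex_ofReal]
    congr 1; ext x
    rw [Complex.mul_conj, Complex.normSq_eq_norm_sq]
  have p2 : ∫ y, ‖H y‖ ^ 2 ∂ν ≤ A * ∫ x, ‖G x‖ ^ 2 ∂μ := by
    have e1 : ((∫ y, ‖H y‖ ^ 2 ∂ν : ℝ) : ℂ) = ∫ x, (∫ x', K x x' * G x' ∂μ) * conj (G x) ∂μ := by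
      rw [← integral_complex_ofReal]
      have : ∀ x, ∫ x', K x x' * G x' ∂μ = ∫ y, a x y * H y ∂ν := fun x => by
        have hint : Integrable (Function.uncurry fun x' y => a x y * conj (a x' y) * G x')
            (μ.prod ν) := by
          refine Integrable.bdd_mul (c := 1) (iG.comp_fst ν) ?_ (Eventually.of_forall fun z => ?_)
          · apply Measurable.aestronglyMeasurable
            apply Measurable.mul
            · exact ha.comp (by fun_prop : Measurable fun z : X × Y => (x, z.2))
            · exact mconj.comp ha
          · rw [norm_mul, Complex.norm_conj]
            exact mul_le_one₀ (hb _ _) (norm_nonneg _) (hb _ _)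
        calc ∫ x', K x x' * G x' ∂μ = ∫ x', ∫ y, a x y * conj (a x' y) * G x' ∂ν ∂μ := by
              congr 1; ext x'; rw [integral_mul_const]
          _ = ∫ y, ∫ x', a x y * conj (a x' y) * G x' ∂μ ∂ν := integral_integral_swap hint
          _ = _ := by
              congr 1; ext y; rw [hH, ← integral_const_mul]; simp only [mul_assoc]
      simp_rw [this]
      rw [integral_mul_kernel_swap ha hb iH iG]
      congr 1; ext y
      rw [Complex.mul_conj, Complex.normSq_eq_norm_sq]
    have bd : ∀ {f : X × X → ℝ} (C : ℝ), AEStronglyMeasurable f (μ.prod μ) → (∀ z, ‖f z‖ ≤ C) →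
        Integrable f (μ.prod μ) := fun C hf h => Integrable.of_bound hf C (Eventually.of_forall h)
    have M0 : 0 ≤ M := integral_nonneg fun _ => norm_nonneg _
    have i1 : Integrable (fun z : X × X => ‖K z.1 z.2‖ * ‖G z.1‖ ^ 2) (μ.prod μ) := by
      refine bd (ν.real Set.univ * M ^ 2) (mK.norm.aestronglyMeasurable.mul (mG.norm.pow 2).comp_fst)
        fun z => ?_
      rw [norm_mul, norm_norm, norm_pow, norm_norm]
      gcongr
      · exact bK _ _
      · exact bG _
    have i2 : Integrable (fun z : X × X => ‖K z.1 z.2‖ * ‖G z.2‖ ^ 2) (μ.prod μ) := by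
      refine bd (ν.real Set.univ * M ^ 2) (mK.norm.aestronglyMeasurable.mul (mG.norm.pow 2).comp_snd)
        fun z => ?_
      rw [norm_mul, norm_norm, norm_pow, norm_norm]
      gcongr
      · exact bK _ _
      · exact bG _
    have i3 : Integrable (fun z : X × X => K z.1 z.2 * G z.2 * conj (G z.1)) (μ.prod μ) := by
      refine Integrable.of_bound ((mK.aestronglyMeasurable.mul mG.comp_snd).mul
        (Complex.continuous_conj.comp_aestronglyMeasurable mG.comp_fst)) (ν.real Set.univ * M * M)
        (Eventually.of_forall fun z => ?_)
      rw [norm_mul, norm_mul, Complex.norm_conj]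
      gcongr
      · exact bK _ _
      · exact bG _
      · exact bG _
    have e2 : ∫ x, (∫ x', K x x' * G x' ∂μ) * conj (G x) ∂μ =
        ∫ z, K z.1 z.2 * G z.2 * conj (G z.1) ∂(μ.prod μ) := by
      rw [integral_prod _ i3]
      congr 1; ext x; exact (integral_mul_const _ _).symm
    have half : ∫ z, ‖K z.1 z.2‖ * ‖G z.1‖ ^ 2 ∂(μ.prod μ) ≤ A * ∫ x, ‖G x‖ ^ 2 ∂μ := by
      rw [integral_prod _ i1, ← integral_const_mul]
      refine integral_mono i1.integral_prod_left (lG.integrable_norm_pow (by norm_num) |>.const_mul A)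
        fun x => ?_
      simp only
      rw [integral_mul_const]
      exact mul_le_mul_of_nonneg_right (hK x) (by positivity)
    have half' : ∫ z, ‖K z.1 z.2‖ * ‖G z.2‖ ^ 2 ∂(μ.prod μ) ≤ A * ∫ x, ‖G x‖ ^ 2 ∂μ := by
      rw [← integral_prod_swap]
      refine le_trans (le_of_eq ?_) half
      congr 1; ext z
      simp only [Prod.fst_swap, Prod.snd_swap]
      rw [sK]
    have e3 : ∫ y, ‖H y‖ ^ 2 ∂ν = ‖((∫ y, ‖H y‖ ^ 2 ∂ν : ℝ) : ℂ)‖ := by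
      rw [Complex.norm_real, Real.norm_of_nonneg (integral_nonneg fun _ => by positivity)]
    rw [e3, e1, e2]
    calc _ ≤ ∫ z, (‖K z.1 z.2‖ * ‖G z.1‖ ^ 2 + ‖K z.1 z.2‖ * ‖G z.2‖ ^ 2) / 2 ∂(μ.prod μ) := by
          refine norm_integral_le_of_norm_le ((i1.add i2).div_const 2) (Eventually.of_forall fun z => ?_)
          rw [norm_mul, norm_mul, Complex.norm_conj]
          have := mul_nonneg (norm_nonneg (K z.1 z.2)) (sq_nonneg (‖G z.1‖ - ‖G z.2‖))
          nlinarith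
      _ ≤ _ := by
          rw [integral_div, integral_add i1 i2]
          linarith
  -- expand the square
  have hexp : ∫ y, ‖(A : ℂ) * F y - H y‖ ^ 2 ∂ν =
      A ^ 2 * ∫ y, ‖F y‖ ^ 2 ∂ν - 2 * A * ∫ x, ‖G x‖ ^ 2 ∂μ + ∫ y, ‖H y‖ ^ 2 ∂ν := by
    have iFH : Integrable (fun y => F y * conj (H y)) ν := by
      refine (hFi.mul_bdd (c := ∫ x, ‖G x‖ ∂μ) ?_ (Eventually.of_forall fun y => ?_))
      · exact Complex.continuous_conj.comp_aestronglyMeasurable mH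
      · rw [Complex.norm_conj]; exact bH y
    have hre : ∫ y, (F y * conj (H y)).re ∂ν = ∫ x, ‖G x‖ ^ 2 ∂μ := by
      have := integral_re iFH
      simp only [RCLike.re_to_complex] at this
      rw [this, p1, Complex.ofReal_re]
    have hpt : ∀ y, ‖(A : ℂ) * F y - H y‖ ^ 2 =
        A ^ 2 * ‖F y‖ ^ 2 - 2 * A * (F y * conj (H y)).re + ‖H y‖ ^ 2 := fun y => by
      simp only [← Complex.normSq_eq_norm_sq, Complex.normSq_apply]
      simp
      ring
    simp_rw [hpt]
    have j1 := (hF.integrable_norm_pow (p := 2) (by norm_num)).const_mul (A ^ 2)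
    have j2 : Integrable (fun y => 2 * A * (F y * conj (H y)).re) ν := iFH.re.const_mul (2 * A)
    have j3 := lH.integrable_norm_pow (p := 2) (by norm_num)
    have e := integral_add (j1.sub j2) j3
    simp only [Pi.sub_apply] at e
    rw [e, integral_sub j1 j2, integral_const_mul, integral_const_mul, hre]
  have hpos : 0 ≤ ∫ y, ‖(A : ℂ) * F y - H y‖ ^ 2 ∂ν := integral_nonneg fun _ => by positivity
  have : A * ∫ x, ‖G x‖ ^ 2 ∂μ ≤ A * (A * ∫ y, ‖F y‖ ^ 2 ∂ν) := by
    rw [hexp] at hpos; nlinarith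
  exact le_of_mul_le_mul_left this hA

/-- Recursively defined index at which `g 0 x, …, g N x` is largest. -/
noncomputable def argmaxUpTo (g : ℕ → X → ENNReal) : ℕ → X → ℕ
  | 0, _ => 0
  | N + 1, x => by
      classical exact if g (N + 1) x ≤ g (argmaxUpTo g N x) x then argmaxUpTo g N x else N + 1

omit [MeasurableSpace X] in
theorem le_argmaxUpTo (g : ℕ → X → ENNReal) (N : ℕ) (x : X) : g N x ≤ g (argmaxUpTo g N x) x := by
  cases N with
  | zero => rfl
  | succ N =>
    rw [argmaxUpTo]
    split_ifs with h
    · exact h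
    · rfl

omit [MeasurableSpace X] in
theorem monotone_argmaxUpTo (g : ℕ → X → ENNReal) :
    Monotone fun N x => g (argmaxUpTo g N x) x := by
  refine monotone_nat_of_le_succ fun N x => ?_
  simp only [argmaxUpTo]
  split_ifs with h
  · rfl
  · exact (not_le.1 h).le

theorem measurable_argmaxUpTo {g : ℕ → X → ENNReal} (hg : ∀ n, Measurable (g n)) (N : ℕ) :
    Measurable (argmaxUpTo g N) := by
  induction N with
  | zero => exact measurable_const
  | succ N ih =>
    have h : Measurable fun x => g (argmaxUpTo g N x) x :=
      (measurable_from_prod_countable_right (f := Function.uncurry g) hg).comp (ih.prodMk measurable_id)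
    exact Measurable.ite (measurableSet_le (hg _) h) ih measurable_const

omit [IsFiniteMeasure μ] in
-- Linearization: the maximum of the first terms is attained along a measurable index, and these
-- maxima increase to the supremum, so monotone convergence applies.
theorem lintegral_iSup_le_of_forall_selection {g : ℕ → X → ENNReal} (hg : ∀ n, Measurable (g n))
    {B : ENNReal} (h : ∀ n : X → ℕ, Measurable n → ∫⁻ x, g (n x) x ∂μ ≤ B) :
    ∫⁻ x, ⨆ n, g n x ∂μ ≤ B := by
  have mgs : Measurable (Function.uncurry g) := measurable_from_prod_countable_right hg
  have mN := measurable_argmaxUpTo hg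
  calc ∫⁻ x, ⨆ n, g n x ∂μ ≤ ∫⁻ x, ⨆ N, g (argmaxUpTo g N x) x ∂μ :=
        lintegral_mono fun x => iSup_mono fun N => le_argmaxUpTo g N x
    _ = ⨆ N, ∫⁻ x, g (argmaxUpTo g N x) x ∂μ :=
        lintegral_iSup (fun N => mgs.comp ((mN N).prodMk measurable_id)) (monotone_argmaxUpTo g)
    _ ≤ B := iSup_le fun N => h _ (mN N)

/-- Maximal `L²` bound for a sequence of oscillatory operators with a common kernel bound. -/
theorem lintegral_iSup_enorm_sq_le {a : ℕ → X → Y → ℂ}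
    (ha : ∀ n, Measurable (Function.uncurry (a n))) (hb : ∀ n x y, ‖a n x y‖ ≤ 1) {F : Y → ℂ}
    (mF : Measurable F) (hF : MemLp F 2 ν) {A : ℝ} (hA : 0 < A) {k : X → X → ℝ}
    (hk : ∀ n n' x x', ‖∫ y, a n x y * conj (a n' x' y) ∂ν‖ ≤ k x x')
    (hki : ∀ x, Integrable (k x) μ) (hkA : ∀ x, ∫ x', k x x' ∂μ ≤ A) :
    ∫⁻ x, ⨆ n, ‖∫ y, a n x y * F y ∂ν‖ₑ ^ 2 ∂μ ≤ ENNReal.ofReal (A * ∫ y, ‖F y‖ ^ 2 ∂ν) := by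
  refine lintegral_iSup_le_of_forall_selection (fun n => ?_) fun n hn => ?_
  · have : Measurable (Function.uncurry fun x y => a n x y * F y) :=
      (ha n).mul (mF.comp measurable_snd)
    exact (this.stronglyMeasurable.integral_prod_right'.measurable).enorm.pow_const 2
  have mas : Measurable fun z : ℕ × (X × Y) => a z.1 z.2.1 z.2.2 :=
    measurable_from_prod_countable_right (f := fun z : ℕ × (X × Y) => a z.1 z.2.1 z.2.2) ha
  have ma : Measurable (Function.uncurry fun x y => a (n x) x y) :=
    mas.comp ((hn.comp measurable_fst).prodMk measurable_id)
  -- The kernel of the linearized operator pairs the index chosen at $x$ with the one chosen at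
  -- $x'$; hence `hk` covers all pairs of indices.
  have key := integral_norm_sq_le_of_kernel (μ := μ) (a := fun x y => a (n x) x y) ma
    (fun x y => hb _ x y) hF hA (fun x => by
      refine le_trans (integral_mono_of_nonneg (Eventually.of_forall fun _ => norm_nonneg _) (hki x)
        (Eventually.of_forall fun x' => hk _ _ x x')) (hkA x))
  refine le_trans (le_of_eq ?_) (ENNReal.ofReal_le_ofReal key)
  have bG : ∀ x, ‖∫ y, a (n x) x y * F y ∂ν‖ ≤ ∫ y, ‖F y‖ ∂ν := fun x => by
    refine norm_integral_le_of_norm_le (hF.integrable (by norm_num)).norm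
      (Eventually.of_forall fun y => ?_)
    rw [norm_mul]
    exact mul_le_of_le_one_left (norm_nonneg _) (hb _ x y)
  have mG : Measurable fun x => ∫ y, a (n x) x y * F y ∂ν := by
    have : Measurable (Function.uncurry fun x y => a (n x) x y * F y) :=
      ma.mul (mF.comp measurable_snd)
    exact this.stronglyMeasurable.integral_prod_right'.measurable
  rw [ofReal_integral_eq_lintegral_ofReal]
  · congr 1; ext x
    rw [← ofReal_norm, ENNReal.ofReal_pow (norm_nonneg _)]
  · exact (MemLp.of_bound mG.aestronglyMeasurable _ (Eventually.of_forall bG)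
      : MemLp _ 2 μ).integrable_norm_pow (by norm_num)
  · exact Eventually.of_forall fun _ => by positivity

end TTStar

/-! ### The maximal estimate on one dyadic shell. -/

section Block

open scoped ComplexConjugate

/-- The dyadic frequency shell `lam < |ξ| ≤ 2 lam`. -/
def shell (lam : ℝ) : Set ℝ := {ξ | lam < |ξ| ∧ |ξ| ≤ 2 * lam}

/-- The space-time wave `e^{i(2π yξ + t|2πξ|^m)}`. -/
noncomputable def wave (m y t ξ : ℝ) : ℂ :=
  Complex.exp (Complex.I * ((2 * Real.pi * y * ξ + t * |2 * Real.pi * ξ| ^ m : ℝ) : ℂ))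

/-- The wave on the line of slope `p.1` through `x` at time `p.2.1`, truncated to frequencies
`|ξ| ≤ p.2.2`. -/
noncomputable def lineWave (m : ℝ) (p : ℝ × ℝ × ℝ) (x ξ : ℝ) : ℂ :=
  if |ξ| ≤ p.2.2 then wave m (x - p.1 * p.2.1) p.2.1 ξ else 0

theorem norm_wave (m y t ξ : ℝ) : ‖wave m y t ξ‖ = 1 := by
  rw [wave, mul_comm, Complex.norm_exp_ofReal_mul_I]

theorem norm_lineWave_le (m : ℝ) (p : ℝ × ℝ × ℝ) (x ξ : ℝ) : ‖lineWave m p x ξ‖ ≤ 1 := by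
  rw [lineWave]; split_ifs
  · rw [norm_wave]
  · simp

theorem continuous_wave {m : ℝ} (hm : 0 < m) :
    Continuous fun z : ℝ × ℝ × ℝ => wave m z.1 z.2.1 z.2.2 := by
  have : Continuous fun z : ℝ × ℝ × ℝ => |2 * Real.pi * z.2.2| ^ m :=
    Continuous.rpow_const (by fun_prop) fun _ => Or.inr hm.le
  unfold wave
  fun_prop

theorem measurable_lineWave {m : ℝ} (hm : 0 < m) (p : ℝ × ℝ × ℝ) :
    Measurable (Function.uncurry (lineWave m p)) := by
  unfold lineWave Function.uncurry
  refine Measurable.ite (measurableSet_le (by fun_prop) measurable_const) ?_ measurable_const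
  exact ((continuous_wave hm).comp
    (by fun_prop : Continuous fun a : ℝ × ℝ => (a.1 - p.1 * p.2.1, p.2.1, a.2))).measurable

theorem measurableSet_shell (lam : ℝ) : MeasurableSet (shell lam) :=
  (measurableSet_lt (f := fun _ : ℝ => lam) (g := fun ξ : ℝ => |ξ|) (by fun_prop) (by fun_prop)).inter
    (measurableSet_le (f := fun ξ : ℝ => |ξ|) (g := fun _ : ℝ => 2 * lam) (by fun_prop) (by fun_prop))

theorem volume_shell_lt_top (lam : ℝ) : volume (shell lam) < ⊤ := by
  refine lt_of_le_of_lt (measure_mono (t := Set.Icc (-(2 * lam)) (2 * lam)) fun ξ hξ => ?_)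
    (by simp)
  exact abs_le.1 hξ.2

/-- The cutoff only shortens the shell to two symmetric intervals, and reflecting the negative one
changes $c$ to $-c$. Bounds uniform in the right endpoint are therefore uniform in the cutoff. -/
theorem norm_setIntegral_shell_le {lam ρ c b m B : ℝ} (hlam : 0 ≤ lam) (hB0 : 0 ≤ B)
    (hB : ∀ β, lam ≤ β → β ≤ 2 * lam → ∀ c' : ℝ, |c'| = |c| →
      ‖∫ ξ in lam..β, Complex.exp (Complex.I * ((c' * ξ + b * ξ ^ m : ℝ) : ℂ))‖ ≤ B) :
    ‖∫ ξ in shell lam ∩ {ξ | |ξ| ≤ ρ},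
      Complex.exp (Complex.I * ((c * ξ + b * |ξ| ^ m : ℝ) : ℂ))‖ ≤ 2 * B := by
  set β := min ρ (2 * lam) with hβ
  rcases lt_or_ge β lam with h | h
  · have : shell lam ∩ {ξ | |ξ| ≤ ρ} = ∅ := by
      ext ξ
      simp only [shell, Set.mem_inter_iff, Set.mem_ofPred_eq, Set.mem_empty_iff_false, iff_false]
      rintro ⟨⟨h1, h2⟩, h3⟩
      have : |ξ| ≤ β := le_min h3 h2
      linarith
    rw [this]
    simpa using hB0
  have hset : shell lam ∩ {ξ | |ξ| ≤ ρ} = Set.Ioc lam β ∪ Set.Ico (-β) (-lam) := by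
    ext ξ
    simp only [shell, Set.mem_inter_iff, Set.mem_ofPred_eq, Set.mem_union, Set.mem_Ioc, Set.mem_Ico]
    constructor
    · rintro ⟨⟨h1, h2⟩, h3⟩
      have h4 : |ξ| ≤ β := le_min h3 h2
      rcases lt_abs.1 h1 with h5 | h5
      · exact Or.inl ⟨h5, (abs_le.1 h4).2⟩
      · exact Or.inr ⟨(abs_le.1 h4).1, by linarith⟩
    · have hβ1 : β ≤ ρ := min_le_left _ _
      have hβ2 : β ≤ 2 * lam := min_le_right _ _
      rintro (⟨h1, h2⟩ | ⟨h1, h2⟩)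
      · rw [abs_of_pos (by linarith)]
        exact ⟨⟨h1, by linarith⟩, by linarith⟩
      · rw [abs_of_neg (by linarith)]
        exact ⟨⟨by linarith, by linarith⟩, by linarith⟩
  have hint : ∀ s : Set ℝ, volume s < ⊤ → IntegrableOn
      (fun ξ : ℝ => Complex.exp (Complex.I * ((c * ξ + b * |ξ| ^ m : ℝ) : ℂ))) s := fun s hs => by
    have : IsFiniteMeasure (volume.restrict s) := ⟨by simpa using hs⟩
    refine Integrable.of_bound (Measurable.aestronglyMeasurable (by fun_prop)) 1
      (Eventually.of_forall fun x => ?_)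
    rw [mul_comm, Complex.norm_exp_ofReal_mul_I]
  rw [hset, setIntegral_union _ measurableSet_Ico (hint _ (by simp)) (hint _ (by simp))]
  · refine (norm_add_le _ _).trans ?_
    rw [two_mul]
    refine add_le_add ?_ ?_
    · rw [← intervalIntegral.integral_of_le h]
      refine le_trans (le_of_eq ?_) (hB β h (min_le_right _ _) c rfl)
      congr 1
      refine intervalIntegral.integral_congr fun x hx => ?_
      rw [Set.uIcc_of_le h] at hx
      rw [abs_of_nonneg (hlam.trans hx.1)]
    · rw [integral_Ico_eq_integral_Ioo, ← integral_Ioc_eq_integral_Ioo,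
        ← intervalIntegral.integral_of_le (by linarith)]
      refine le_trans (le_of_eq ?_) (hB β h (min_le_right _ _) (-c) (abs_neg c))
      rw [← intervalIntegral.integral_comp_neg]
      congr 1
      refine intervalIntegral.integral_congr fun x hx => ?_
      rw [Set.uIcc_of_le h] at hx
      rw [abs_neg, abs_of_nonneg (hlam.trans hx.1)]
      congr 3
      ring
  · rw [Set.disjoint_left]
    intro x hx hx'
    linarith [hx.1, hx'.2]

theorem lineWave_mul_conj (m : ℝ) (p q : ℝ × ℝ × ℝ) (x x' ξ : ℝ) :
    lineWave m p x ξ * conj (lineWave m q x' ξ) =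
      Set.indicator {ξ | |ξ| ≤ min p.2.2 q.2.2} (fun ξ =>
        Complex.exp (Complex.I * ((2 * Real.pi * ((x - p.1 * p.2.1) - (x' - q.1 * q.2.1)) * ξ +
          ((p.2.1 - q.2.1) * (2 * Real.pi) ^ m) * |ξ| ^ m : ℝ) : ℂ))) ξ := by
  simp only [lineWave, Set.indicator, Set.mem_ofPred_eq, le_min_iff]
  by_cases h1 : |ξ| ≤ p.2.2 <;> by_cases h2 : |ξ| ≤ q.2.2 <;> simp only [h1, h2, if_true, if_false,
    and_self, and_true, and_false, zero_mul, map_zero, mul_zero]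
  rw [wave, wave, ← Complex.exp_conj, ← Complex.exp_add, map_mul, Complex.conj_I, Complex.conj_ofReal,
    abs_mul, Real.mul_rpow (abs_nonneg _) (abs_nonneg _), abs_of_pos Real.two_pi_pos]
  congr 1
  push_cast
  ring

/-- Pointwise bound for the kernel of `TT*` on one shell, for two points of lines with almost the
same slope. -/
theorem norm_kernel_le {m A lam : ℝ} (hm0 : 0 < m) (hm1 : m < 1) (hlam : 1 ≤ lam)
    {p q : ℝ × ℝ × ℝ} (hp : |p.1| ≤ A) (htq : |q.2.1| ≤ 1)
    (hpq : |p.1 - q.1| ≤ 2 * lam ^ (-(m / 2))) (x x' : ℝ) :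
    ‖∫ ξ in shell lam, lineWave m p x ξ * conj (lineWave m q x' ξ)‖ ≤
      Set.indicator (Set.Icc (x - 8 * lam ^ (-(m / 2))) (x + 8 * lam ^ (-(m / 2))))
        (fun _ => 2 * lam) x' +
      (8 + 20 * √(16 * (A + 1) / (m * (1 - m)))) * lam ^ (1 - m / 2) * |x - x'| ^ (-(1 / 2) : ℝ) := by
  have hl0 : 0 < lam := by linarith
  have h1m : 0 < 1 - m := by linarith
  have hA : 0 ≤ A := (abs_nonneg _).trans hp
  set δ := lam ^ (-(m / 2)) with hδ
  have hδ0 : 0 < δ := Real.rpow_pos_of_pos hl0 _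
  simp_rw [lineWave_mul_conj]
  rw [setIntegral_indicator (measurableSet_le (by fun_prop) measurable_const)]
  set b := p.2.1 - q.2.1 with hb
  set u := (x - p.1 * p.2.1) - (x' - q.1 * q.2.1) with hu
  set d := |x - x'| with hd
  have hnn : 0 ≤ (8 + 20 * √(16 * (A + 1) / (m * (1 - m)))) * lam ^ (1 - m / 2) *
      d ^ (-(1 / 2) : ℝ) := by positivity
  -- Near the diagonal only the length of the shell is used. This includes $d=0$, where `rpow` gives
  -- the singular term the value $0$. Farther out, the slope discrepancy shifts positions by at most
  -- $2\delta<d/4$.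
  by_cases hx : d ≤ 8 * δ
  · have hmem : x' ∈ Set.Icc (x - 8 * δ) (x + 8 * δ) := by
      have := abs_le.1 hx
      constructor <;> linarith [this.1, this.2]
    rw [Set.indicator_of_mem hmem]
    refine le_trans (norm_setIntegral_shell_le hl0.le hl0.le fun β h1 h2 c' _ => ?_) (by linarith)
    exact (norm_integral_exp_le_sub h1).trans (by linarith)
  push Not at hx
  have hd0 : 0 < d := by linarith
  have hnmem : x' ∉ Set.Icc (x - 8 * δ) (x + 8 * δ) := fun h => by
    have : d ≤ 8 * δ := abs_le.2 ⟨by linarith [h.2], by linarith [h.1]⟩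
    linarith
  rw [Set.indicator_of_notMem hnmem, zero_add]
  have hpi : 1 ≤ 2 * Real.pi := by linarith [Real.pi_gt_three]
  have hpm1 : 1 ≤ (2 * Real.pi) ^ m := Real.one_le_rpow hpi hm0.le
  have hpm2 : (2 * Real.pi) ^ m ≤ 2 * Real.pi := by
    calc (2 * Real.pi) ^ m ≤ (2 * Real.pi) ^ (1 : ℝ) := Real.rpow_le_rpow_of_exponent_le hpi hm1.le
      _ = _ := Real.rpow_one _
  have hb' : |b * (2 * Real.pi) ^ m| = |b| * (2 * Real.pi) ^ m := by
    rw [abs_mul, abs_of_pos (by positivity : (0 : ℝ) < (2 * Real.pi) ^ m)]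
  have hdl : d ^ (-(1 / 2) : ℝ) * d ^ (-(1 / 2) : ℝ) = 1 / d := by
    rw [← Real.rpow_add hd0]; norm_num [Real.rpow_neg_one]
  -- If the time difference $b$ is small against $d$, the linear phase dominates. Otherwise
  -- $|b|\gtrsim d$, so the second derivative is $\gtrsim d\lambda^{m-2}$, which produces
  -- $\lambda^{1-m/2}d^{-1/2}$.
  by_cases hbd : |b| * (4 * (A + 1)) ≤ d
  · -- non-stationary phase
    have hu1 : |b| + d / 2 ≤ |u| := by
      have e : x - x' = u + (p.1 * b + (p.1 - q.1) * q.2.1) := by rw [hu, hb]; ring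
      have h1 : |p.1 * b| ≤ A * |b| := by rw [abs_mul]; gcongr
      have h2 : |(p.1 - q.1) * q.2.1| ≤ 2 * δ := by
        rw [abs_mul]
        calc _ ≤ 2 * δ * 1 := by gcongr
          _ = _ := mul_one _
      have h3 : d ≤ |u| + (A * |b| + 2 * δ) := by
        rw [hd, e]
        refine (abs_add_le _ _).trans ?_
        gcongr
        exact (abs_add_le _ _).trans (add_le_add h1 h2)
      nlinarith
    have hcb : |b * (2 * Real.pi) ^ m| + d ≤ |2 * Real.pi * u| := by
      rw [hb', abs_mul, abs_of_pos Real.two_pi_pos]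
      have h1 : |b| * (2 * Real.pi) ^ m ≤ |b| * (2 * Real.pi) := by gcongr
      nlinarith [Real.pi_gt_three]
    refine le_trans (norm_setIntegral_shell_le (B := 4 / d) hl0.le (by positivity)
      fun β h1 h2 c' hc' => ?_) ?_
    · exact norm_integral_powerPhase_le_of_lt hm0 hm1 hlam h1 hd0 (by rw [hc']; exact hcb)
    · have h1 : d ^ (-(1 / 2) : ℝ) ≤ lam ^ (1 - m / 2) := by
        calc d ^ (-(1 / 2) : ℝ) ≤ δ ^ (-(1 / 2) : ℝ) :=
              Real.rpow_le_rpow_of_nonpos hδ0 (by linarith) (by norm_num)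
          _ = lam ^ (m / 4) := by
              rw [hδ, ← Real.rpow_mul hl0.le]; congr 1; ring
          _ ≤ _ := Real.rpow_le_rpow_of_exponent_le hlam (by linarith)
      have e : 2 * (4 / d) = 8 * (d ^ (-(1 / 2) : ℝ) * d ^ (-(1 / 2) : ℝ)) := by rw [hdl]; ring
      rw [e, ← mul_assoc]
      gcongr
      have := Real.sqrt_nonneg (16 * (A + 1) / (m * (1 - m)))
      linarith
  · -- stationary phase
    push Not at hbd
    have hb0 : b ≠ 0 := fun h => by rw [h] at hbd; simp at hbd; linarith
    have hb0' : b * (2 * Real.pi) ^ m ≠ 0 := mul_ne_zero hb0 (by positivity)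
    refine le_trans (norm_setIntegral_shell_le hl0.le (by positivity) fun β h1 h2 c' hc' =>
      norm_integral_powerPhase_le_rpow hm0 hm1 hl0 le_rfl h1 h2 hb0') ?_
    have hge : d / (4 * (A + 1)) * (m * ((1 - m) * (lam ^ (m - 2) / 4))) ≤
        |b * (2 * Real.pi) ^ m| * (m * ((1 - m) * (2 * lam) ^ (m - 2))) := by
      have h1 : d / (4 * (A + 1)) ≤ |b * (2 * Real.pi) ^ m| := by
        rw [hb', div_le_iff₀ (by positivity)]
        have : |b| ≤ |b| * (2 * Real.pi) ^ m := le_mul_of_one_le_right (abs_nonneg _) hpm1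
        nlinarith
      have h2 : lam ^ (m - 2) / 4 ≤ (2 * lam) ^ (m - 2) := by
        rw [Real.mul_rpow (by norm_num) hl0.le]
        have : (1 / 4 : ℝ) ≤ 2 ^ (m - 2) := by
          calc (1 / 4 : ℝ) = 2 ^ (-2 : ℝ) := by
                rw [Real.rpow_neg (by norm_num)]; norm_num
            _ ≤ _ := Real.rpow_le_rpow_of_exponent_le (by norm_num) (by linarith)
        have h3 : 0 < lam ^ (m - 2) := Real.rpow_pos_of_pos hl0 _
        nlinarith
      gcongr
    have hpos : 0 < d / (4 * (A + 1)) * (m * ((1 - m) * (lam ^ (m - 2) / 4))) := by positivity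
    have hsq : 1 / √(d / (4 * (A + 1)) * (m * ((1 - m) * (lam ^ (m - 2) / 4)))) =
        √(16 * (A + 1) / (m * (1 - m))) * lam ^ (1 - m / 2) * d ^ (-(1 / 2) : ℝ) := by
      have e1 : d ^ (-(1 / 2) : ℝ) = √(1 / d) := by
        rw [Real.rpow_neg hd0.le, ← Real.sqrt_eq_rpow, one_div, Real.sqrt_inv]
      have e2 : lam ^ (1 - m / 2) = √(1 / lam ^ (m - 2)) := by
        rw [Real.sqrt_eq_rpow, one_div, ← Real.rpow_neg hl0.le, ← Real.rpow_mul hl0.le]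
        congr 1; ring
      rw [e1, e2, ← Real.sqrt_mul (by positivity), ← Real.sqrt_mul (by positivity), one_div,
        ← Real.sqrt_inv]
      congr 1
      field_simp
      norm_num
    calc 2 * (10 / √(|b * (2 * Real.pi) ^ m| * (m * ((1 - m) * (2 * lam) ^ (m - 2)))))
        ≤ 2 * (10 / √(d / (4 * (A + 1)) * (m * ((1 - m) * (lam ^ (m - 2) / 4))))) := by
          gcongr
      _ = 20 * (1 / √(d / (4 * (A + 1)) * (m * ((1 - m) * (lam ^ (m - 2) / 4))))) := by ring
      _ = (20 * √(16 * (A + 1) / (m * (1 - m)))) * lam ^ (1 - m / 2) * d ^ (-(1 / 2) : ℝ) := by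
          rw [hsq]; ring
      _ ≤ _ := by gcongr; linarith

theorem exists_integrable_abs_rpow_le : ∃ h : ℝ → ℝ, Integrable h ∧ (∀ u, 0 ≤ h u) ∧
    ∀ u, |u| ^ (-(1 / 2) : ℝ) ≤ h u + 1 := by
  set g : ℝ → ℝ := (Set.Ioc (0 : ℝ) 1).indicator fun u => u ^ (-(1 / 2) : ℝ) with hg
  have ig : Integrable g := by
    rw [hg, integrable_indicator_iff measurableSet_Ioc]
    exact (intervalIntegral.intervalIntegrable_rpow' (a := 0) (b := 1) (by norm_num)).1
  have gnn : ∀ u, 0 ≤ g u := fun u =>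
    Set.indicator_nonneg (fun x hx => Real.rpow_nonneg hx.1.le _) u
  refine ⟨fun u => g u + g (-u), ig.add ig.comp_neg, fun u => add_nonneg (gnn _) (gnn _), fun u => ?_⟩
  have key : ∀ v : ℝ, 0 ≤ v → v ^ (-(1 / 2) : ℝ) ≤ g v + 1 := fun v hv => by
    rcases hv.eq_or_lt with rfl | hv
    · rw [Real.zero_rpow (by norm_num)]
      linarith [gnn 0]
    rcases le_or_gt v 1 with h | h
    · rw [hg, Set.indicator_of_mem (show v ∈ Set.Ioc (0 : ℝ) 1 from ⟨hv, h⟩)]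
      linarith
    · linarith [gnn v, Real.rpow_le_one_of_one_le_of_nonpos h.le (by norm_num : (-(1 / 2) : ℝ) ≤ 0)]
  rcases le_total 0 u with h | h
  · rw [abs_of_nonneg h]
    linarith [key u h, gnn (-u)]
  · rw [abs_of_nonpos h]
    linarith [key (-u) (by linarith), gnn u]

/-- Translation invariance makes the bound uniform in $x$, as Schur's test requires. -/
theorem exists_setIntegral_abs_sub_rpow_le (k : ℝ) : ∃ D : ℝ, 0 ≤ D ∧ ∀ x,
    IntegrableOn (fun x' => |x - x'| ^ (-(1 / 2) : ℝ)) (Set.Icc (-k) k) ∧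
    ∫ x' in Set.Icc (-k) k, |x - x'| ^ (-(1 / 2) : ℝ) ≤ D := by
  obtain ⟨h, ih, hnn, hle⟩ := exists_integrable_abs_rpow_le
  have hI : 0 ≤ ∫ u, h u := integral_nonneg hnn
  refine ⟨(∫ u, h u) + volume.real (Set.Icc (-k) k), by positivity, fun x => ?_⟩
  have i1 : Integrable fun x' => h (x - x') := ih.comp_sub_left x
  have i2 : IntegrableOn (fun x' => h (x - x') + 1) (Set.Icc (-k) k) :=
    i1.integrableOn.add (integrable_const 1)
  have i3 : IntegrableOn (fun x' => |x - x'| ^ (-(1 / 2) : ℝ)) (Set.Icc (-k) k) := by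
    refine Integrable.mono' i2 (Measurable.aestronglyMeasurable (by fun_prop))
      (Eventually.of_forall fun x' => ?_)
    rw [Real.norm_of_nonneg (by positivity)]
    exact hle _
  refine ⟨i3, ?_⟩
  calc ∫ x' in Set.Icc (-k) k, |x - x'| ^ (-(1 / 2) : ℝ)
      ≤ ∫ x' in Set.Icc (-k) k, (h (x - x') + 1) := integral_mono i3 i2 fun x' => hle _
    _ = (∫ x' in Set.Icc (-k) k, h (x - x')) + volume.real (Set.Icc (-k) k) := by
        rw [integral_add i1.integrableOn (integrable_const 1)]
        simp
    _ ≤ _ := by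
        gcongr
        rw [← integral_sub_left_eq_self h volume x]
        exact setIntegral_le_integral i1 (Eventually.of_forall fun x' => hnn _)

/-- Maximal estimate on one shell for lines whose slopes lie in a common short interval. -/
theorem exists_shell_maximal_bound {m A : ℝ} (hm0 : 0 < m) (hm1 : m < 1) (hA : 0 ≤ A) (k : ℝ) :
    ∃ C : ℝ, 0 < C ∧ ∀ lam : ℝ, 1 ≤ lam → ∀ q : ℕ → ℝ × ℝ × ℝ,
      (∀ n, |(q n).1| ≤ A ∧ |(q n).2.1| ≤ 1) → ∀ c : ℝ, ∀ F : ℝ → ℂ, Measurable F →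
      MemLp F 2 (volume.restrict (shell lam)) →
      ∫⁻ x in Set.Icc (-k) k, ⨆ n, ‖∫ ξ in shell lam,
        (if |(q n).1 - c| ≤ lam ^ (-(m / 2)) then lineWave m (q n) x ξ else 0) * F ξ‖ₑ ^ 2 ≤
      ENNReal.ofReal (C * lam ^ (1 - m / 2) * ∫ ξ in shell lam, ‖F ξ‖ ^ 2) := by
  obtain ⟨D, hD0, hD⟩ := exists_setIntegral_abs_sub_rpow_le k
  set E := 8 + 20 * √(16 * (A + 1) / (m * (1 - m))) with hE
  have hE0 : 0 < E := by positivity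
  refine ⟨32 + E * D, by positivity, fun lam hlam q hq c F mF hF => ?_⟩
  have hl0 : 0 < lam := by linarith
  set δ := lam ^ (-(m / 2)) with hδ
  have hδ0 : 0 < δ := Real.rpow_pos_of_pos hl0 _
  have hlδ : lam * δ = lam ^ (1 - m / 2) := by
    rw [hδ, sub_eq_add_neg, Real.rpow_add hl0, Real.rpow_one]
  have : IsFiniteMeasure (volume.restrict (shell lam)) := ⟨by simpa using volume_shell_lt_top lam⟩
  set I : ℝ → ℝ → ℝ := fun x x' => Set.indicator (Set.Icc (x - 8 * δ) (x + 8 * δ))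
    (fun _ => 2 * lam) x' with hI
  have hI0 : ∀ x x', 0 ≤ I x x' := fun x x' => Set.indicator_nonneg (fun _ _ => by linarith) _
  have iI : ∀ x, Integrable (I x) := fun x => by
    rw [hI, integrable_indicator_iff measurableSet_Icc]
    exact integrableOn_const (by simp)
  have iI2 : ∀ x, ∫ x', I x x' = 32 * lam ^ (1 - m / 2) := fun x => by
    simp only [hI]
    rw [integral_indicator measurableSet_Icc, setIntegral_const, Real.volume_real_Icc_of_le (by linarith),
      smul_eq_mul, ← hlδ]
    ring
  refine lintegral_iSup_enorm_sq_le (k := fun x x' => I x x' + E * lam ^ (1 - m / 2) *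
    |x - x'| ^ (-(1 / 2) : ℝ)) (fun n => ?_) (fun n x y => ?_) mF hF (by positivity)
    (fun n n' x x' => ?_) (fun x => ?_) (fun x => ?_)
  · split_ifs
    · exact measurable_lineWave hm0 _
    · exact measurable_const
  · split_ifs
    · exact norm_lineWave_le _ _ _ _
    · simp
  · have hnn : 0 ≤ I x x' + E * lam ^ (1 - m / 2) * |x - x'| ^ (-(1 / 2) : ℝ) :=
      add_nonneg (hI0 _ _) (by positivity)
    by_cases h1 : |(q n).1 - c| ≤ δ
    · by_cases h2 : |(q n').1 - c| ≤ δ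
      · simp only [h1, h2, if_true]
        refine norm_kernel_le hm0 hm1 hlam (hq n).1 (hq n').2 ?_ x x'
        have h3 := abs_sub_le (q n).1 c (q n').1
        rw [abs_sub_comm c] at h3
        linarith
      · simpa [h1, h2] using hnn
    · simpa [h1] using hnn
  · exact (iI x).integrableOn.add ((hD x).1.const_mul _)
  · rw [integral_add (iI x).integrableOn ((hD x).1.const_mul _), integral_const_mul]
    have h1 : ∫ x' in Set.Icc (-k) k, I x x' ≤ 32 * lam ^ (1 - m / 2) := by
      rw [← iI2 x]
      exact setIntegral_le_integral (iI x) (Eventually.of_forall fun x' => hI0 _ _)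
    have h2 : E * lam ^ (1 - m / 2) * ∫ x' in Set.Icc (-k) k, |x - x'| ^ (-(1 / 2) : ℝ) ≤
        E * lam ^ (1 - m / 2) * D := by
      gcongr
      exact (hD x).2
    linarith

/-- Maximal estimate on one shell for lines whose slopes are covered by finitely many short
intervals. -/
theorem exists_shell_maximal_bound_of_cover {m A : ℝ} (hm0 : 0 < m) (hm1 : m < 1) (hA : 0 ≤ A)
    (k : ℝ) :
    ∃ C : ℝ, 0 < C ∧ ∀ lam : ℝ, 1 ≤ lam → ∀ q : ℕ → ℝ × ℝ × ℝ,
      (∀ n, |(q n).1| ≤ A ∧ |(q n).2.1| ≤ 1) → ∀ N : Finset ℝ,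
      (∀ n, ∃ c ∈ N, |(q n).1 - c| ≤ lam ^ (-(m / 2))) → ∀ F : ℝ → ℂ, Measurable F →
      MemLp F 2 (volume.restrict (shell lam)) →
      ∫⁻ x in Set.Icc (-k) k, ⨆ n, ‖∫ ξ in shell lam, lineWave m (q n) x ξ * F ξ‖ₑ ^ 2 ≤
      ENNReal.ofReal (C * (N.card * lam ^ (1 - m / 2)) * ∫ ξ in shell lam, ‖F ξ‖ ^ 2) := by
  obtain ⟨C, hC0, hC⟩ := exists_shell_maximal_bound hm0 hm1 hA k
  refine ⟨C, hC0, fun lam hlam q hq N hN F mF hF => ?_⟩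
  have : IsFiniteMeasure (volume.restrict (shell lam)) := ⟨by simpa using volume_shell_lt_top lam⟩
  -- Lines far from $c$ are replaced by $0$ instead of being removed, so every group keeps the index
  -- set `ℕ`.
  set f : ℝ → ℝ → ENNReal := fun c x => ⨆ n, ‖∫ ξ in shell lam,
        (if |(q n).1 - c| ≤ lam ^ (-(m / 2)) then lineWave m (q n) x ξ else 0) * F ξ‖ₑ ^ 2 with hf
  have mf : ∀ c, Measurable (f c) := fun c => by
    refine Measurable.iSup fun n => ?_
    have : Measurable (Function.uncurry fun x ξ =>
        (if |(q n).1 - c| ≤ lam ^ (-(m / 2)) then lineWave m (q n) x ξ else 0) * F ξ) := by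
      split_ifs
      · exact (measurable_lineWave hm0 _).mul (mF.comp measurable_snd)
      · exact measurable_const.mul (mF.comp measurable_snd)
    exact (this.stronglyMeasurable.integral_prod_right'.measurable).enorm.pow_const 2
  calc _ ≤ ∫⁻ x in Set.Icc (-k) k, ∑ c ∈ N, f c x := by
        refine lintegral_mono fun x => iSup_le fun n => ?_
        obtain ⟨c, hc, hcn⟩ := hN n
        refine le_trans ?_ (Finset.single_le_sum (f := fun c => f c x) (fun _ _ => zero_le) hc)
        refine le_trans (le_of_eq ?_) (le_iSup _ n)
        simp only [hcn, if_true]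
    _ = ∑ c ∈ N, ∫⁻ x in Set.Icc (-k) k, f c x := lintegral_finsetSum _ fun c _ => mf c
    _ ≤ ∑ c ∈ N, ENNReal.ofReal (C * lam ^ (1 - m / 2) * ∫ ξ in shell lam, ‖F ξ‖ ^ 2) :=
        Finset.sum_le_sum fun c _ => hC lam hlam q hq c F mF hF
    _ = _ := by
        rw [Finset.sum_const, nsmul_eq_mul, ← ENNReal.ofReal_natCast,
          ← ENNReal.ofReal_mul (Nat.cast_nonneg _)]
        congr 1
        ring

end Block

/-! ### Covering numbers and Minkowski dimension. -/

section Minkowski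

theorem coveringNumber_ne_top {Θ : Set ℝ} (hΘ : IsCompact Θ) {δ : ℝ≥0} (hδ : δ ≠ 0) :
    Metric.coveringNumber δ Θ ≠ ⊤ := by
  obtain ⟨N, hN, hNf, hNc⟩ := Metric.exists_finite_isCover_of_isCompact hδ hΘ
  exact ((hNc.coveringNumber_le_encard hN).trans_lt hNf.encard_lt_top).ne

theorem exists_finset_cover {Θ : Set ℝ} (hΘ : IsCompact Θ) {δ : ℝ≥0} (hδ : δ ≠ 0) :
    ∃ N : Finset ℝ, (N.card : ℝ) = (Metric.coveringNumber δ Θ).toNat ∧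
      ∀ θ ∈ Θ, ∃ c ∈ N, |θ - c| ≤ δ := by
  obtain ⟨N, -, hNf, hNc, hN⟩ :=
    Metric.exists_set_encard_eq_coveringNumber (coveringNumber_ne_top hΘ hδ)
  refine ⟨hNf.toFinset, ?_, fun θ hθ => ?_⟩
  · rw [← hN, hNf.encard_eq_coe_toFinset_card, ENat.toNat_natCast]
  · obtain ⟨c, hc, hd⟩ := hNc hθ
    refine ⟨c, by simpa using hc, ?_⟩
    have hd' : edist θ c ≤ δ := hd
    rw [edist_nndist] at hd'
    have h2 : nndist θ c ≤ δ := by exact_mod_cast hd'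
    rw [← Real.dist_eq]
    exact_mod_cast h2

theorem coveringNumber_toNat_le {Θ : Set ℝ} (hne : Θ.Nonempty) {A : ℝ} (hA : ∀ θ ∈ Θ, |θ| ≤ A)
    {δ : ℝ≥0} (hδ : 0 < δ) :
    ((Metric.coveringNumber δ Θ).toNat : ℝ) ≤ 4 * A / δ + 3 := by
  obtain ⟨θ0, hθ0⟩ := hne
  have hA0 : 0 ≤ A := (abs_nonneg _).trans (hA θ0 hθ0)
  have hδ' : (0 : ℝ) < δ := hδ
  set M := ⌈2 * A / δ⌉₊ with hM
  set N : Finset ℝ := (Finset.Icc (-(M : ℤ)) M).image fun i : ℤ => (i : ℝ) * (δ / 2) with hN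
  -- Grid points need not lie in $\Theta$; doubling the radius from $\delta/2$ to $\delta$ allows
  -- centres in $\Theta$.
  have hcov : Metric.IsCover (δ / 2) Θ (N : Set ℝ) := by
    intro θ hθ
    set r := θ / ((δ : ℝ) / 2) with hr
    have hround := abs_le.1 (abs_sub_round r)
    have hrM : |r| ≤ M := by
      refine le_trans ?_ (Nat.le_ceil _)
      rw [hr, abs_div, abs_of_pos (by positivity : (0 : ℝ) < δ / 2), div_le_div_iff₀ (by positivity)
        hδ']
      nlinarith [hA θ hθ]
    have hrM' := abs_le.1 hrM
    refine ⟨round r * ((δ : ℝ) / 2), ?_, ?_⟩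
    · simp only [hN, Finset.coe_image, Set.mem_image, Finset.coe_Icc]
      refine ⟨round r, ⟨?_, ?_⟩, rfl⟩
      · have : (-(M : ℝ)) - 1 < round r := by linarith [hround.2]
        have : (-(M : ℤ)) - 1 < round r := by exact_mod_cast this
        omega
      · have : (round r : ℝ) < M + 1 := by linarith [hround.1]
        have : round r < (M : ℤ) + 1 := by exact_mod_cast this
        omega
    · change edist θ (round r * ((δ : ℝ) / 2)) ≤ ((δ / 2 : ℝ≥0) : ENNReal)
      rw [edist_nndist, ENNReal.coe_le_coe, ← NNReal.coe_le_coe, coe_nndist, Real.dist_eq]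
      have e : θ = r * ((δ : ℝ) / 2) := by rw [hr]; field_simp
      have : θ - round r * ((δ : ℝ) / 2) = (r - round r) * ((δ : ℝ) / 2) := by
        rw [sub_mul, ← e]
      rw [this, abs_mul, abs_of_pos (by positivity : (0 : ℝ) < δ / 2)]
      push_cast
      have := abs_sub_round r
      nlinarith
  have h1 := (Metric.coveringNumber_two_mul_le_externalCoveringNumber (δ / 2) Θ).trans
    hcov.externalCoveringNumber_le_encard
  rw [mul_div_cancel₀ δ (two_ne_zero), Set.encard_coe_eq_coe_finsetCard] at h1
  have h2 : (Metric.coveringNumber δ Θ).toNat ≤ N.card := ENat.toNat_le_of_le_natCast h1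
  have h3 : N.card ≤ 2 * M + 1 := by
    refine Finset.card_image_le.trans ?_
    rw [Int.card_Icc]; omega
  have h4 : (M : ℝ) < 2 * A / δ + 1 := Nat.ceil_lt_add_one (by positivity)
  have h5 : ((Metric.coveringNumber δ Θ).toNat : ℝ) ≤ 2 * M + 1 := by exact_mod_cast h2.trans h3
  have : 4 * A / (δ : ℝ) = 2 * (2 * A / δ) := by ring
  linarith

theorem one_le_coveringNumber_toNat {Θ : Set ℝ} (hΘ : IsCompact Θ) (hne : Θ.Nonempty)
    {δ : ℝ≥0} (hδ : δ ≠ 0) : (1 : ℝ) ≤ (Metric.coveringNumber δ Θ).toNat := by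
  have h1 : (Metric.coveringNumber δ Θ).toNat ≠ 0 := by
    rw [Ne, ENat.toNat_eq_zero, not_or]
    exact ⟨(Metric.coveringNumber_pos_iff.2 hne).ne', coveringNumber_ne_top hΘ hδ⟩
  exact_mod_cast Nat.one_le_iff_ne_zero.2 h1

/-- A real `limsup` is meaningful only for bounded families. The trivial bound
$N(\delta)=O(1/\delta)$ supplies this. -/
theorem eventually_coveringNumber_ratio_mem {Θ : Set ℝ} (hΘ : IsCompact Θ) (hne : Θ.Nonempty) :
    ∃ B : ℝ, ∀ᶠ δ : ℝ≥0 in 𝓝[>] 0,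
      Real.log ((Metric.coveringNumber δ Θ).toNat : ℝ) / Real.log (1 / (δ : ℝ)) ∈ Set.Icc 0 B := by
  obtain ⟨A, hA⟩ := hΘ.isBounded.exists_norm_le
  have hA0 : 0 ≤ A := (norm_nonneg _).trans (hA _ hne.some_mem)
  refine ⟨Real.log (4 * A + 3) + 1, ?_⟩
  have hr : (0 : ℝ≥0) < Real.toNNReal (Real.exp (-1)) := by simp [Real.exp_pos]
  filter_upwards [Ioo_mem_nhdsGT hr] with δ hδ
  have hδ0 : (0 : ℝ) < δ := hδ.1
  have hδ1 : (δ : ℝ) < Real.exp (-1) := Real.lt_toNNReal_iff_coe_lt.1 hδ.2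
  have hδle : (δ : ℝ) ≤ 1 := hδ1.le.trans (by rw [Real.exp_le_one_iff]; norm_num)
  have hlog : 1 ≤ Real.log (1 / (δ : ℝ)) := by
    rw [one_div, Real.log_inv]
    have := (Real.log_lt_iff_lt_exp hδ0).2 hδ1
    linarith
  have h1 := one_le_coveringNumber_toNat hΘ hne (δ := δ) hδ.1.ne'
  have h2 := coveringNumber_toNat_le hne (fun θ hθ => hA θ hθ) hδ.1
  have h3 : ((Metric.coveringNumber δ Θ).toNat : ℝ) ≤ (4 * A + 3) * (1 / δ) := by
    refine h2.trans ?_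
    have : (1 : ℝ) ≤ 1 / δ := by rw [le_div_iff₀ hδ0]; linarith
    have e : 4 * A / (δ : ℝ) = 4 * A * (1 / δ) := by ring
    rw [e]
    nlinarith
  refine ⟨div_nonneg (Real.log_nonneg h1) (by linarith), ?_⟩
  rw [div_le_iff₀ (by linarith)]
  calc _ ≤ Real.log ((4 * A + 3) * (1 / δ)) := Real.log_le_log (by linarith) h3
    _ = Real.log (4 * A + 3) + Real.log (1 / δ) :=
        Real.log_mul (by positivity) (by positivity)
    _ ≤ _ := by
        have := Real.log_nonneg (by linarith : (1 : ℝ) ≤ 4 * A + 3)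
        nlinarith

theorem minkowskiDim_nonneg {Θ : Set ℝ} (hΘ : IsCompact Θ) (hne : Θ.Nonempty) :
    0 ≤ minkowskiDim Θ := by
  obtain ⟨B, hB⟩ := eventually_coveringNumber_ratio_mem hΘ hne
  exact le_limsup_of_frequently_le (hB.mono fun δ h => h.1).frequently
    ⟨B, eventually_map.2 (hB.mono fun δ h => h.2)⟩

/-- A set of dimension less than `β` is covered by `O(δ^{-β})` intervals of radius `δ`. -/
theorem exists_coveringNumber_le_rpow {Θ : Set ℝ} (hΘ : IsCompact Θ) (hne : Θ.Nonempty) {β : ℝ}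
    (hβ : minkowskiDim Θ < β) :
    ∃ C : ℝ, 0 < C ∧ ∀ δ : ℝ≥0, 0 < δ → δ ≤ 1 →
      ((Metric.coveringNumber δ Θ).toNat : ℝ) ≤ C * (δ : ℝ) ^ (-β) := by
  have hβ0 : 0 < β := (minkowskiDim_nonneg hΘ hne).trans_lt hβ
  obtain ⟨B, hB⟩ := eventually_coveringNumber_ratio_mem hΘ hne
  have hev := eventually_lt_of_limsup_lt hβ ⟨B, eventually_map.2 (hB.mono fun δ h => h.2)⟩
  obtain ⟨ε, hε0, hε⟩ := mem_nhdsGT_iff_exists_Ioo_subset.1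
    (hev.and (Ioo_mem_nhdsGT (zero_lt_one' ℝ≥0)))
  have hε0' : 0 < ε := hε0
  have hε2 : 0 < ε / 2 := half_pos hε0'
  set N0 : ℝ := ((Metric.coveringNumber (ε / 2) Θ).toNat : ℝ) with hN0
  have hN01 : 1 ≤ N0 := one_le_coveringNumber_toNat hΘ hne hε2.ne'
  refine ⟨N0, by linarith, fun δ hδ0 hδ1 => ?_⟩
  have hδ0' : (0 : ℝ) < δ := hδ0
  have hpow : 1 ≤ (δ : ℝ) ^ (-β) :=
    Real.one_le_rpow_of_pos_of_le_one_of_nonpos hδ0' hδ1 (by linarith)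
  have h1 := one_le_coveringNumber_toNat hΘ hne (δ := δ) hδ0.ne'
  -- Small radii use the limsup; for the others $N(\delta)\le N(\varepsilon/2)$ while
  -- $\delta^{-\beta}\ge1$.
  rcases lt_or_ge δ ε with h | h
  · obtain ⟨h2, h3⟩ := hε ⟨hδ0, h⟩
    have hlog : 0 < Real.log (1 / (δ : ℝ)) := by
      apply Real.log_pos
      rw [lt_div_iff₀ hδ0', one_mul]
      exact h3.2
    rw [div_lt_iff₀ hlog] at h2
    have h4 : ((Metric.coveringNumber δ Θ).toNat : ℝ) ≤ (δ : ℝ) ^ (-β) := by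
      rw [← Real.log_le_log_iff (by linarith) (by positivity), Real.log_rpow hδ0']
      rw [one_div, Real.log_inv] at h2
      linarith
    nlinarith
  · have h2 : Metric.coveringNumber δ Θ ≤ Metric.coveringNumber (ε / 2) Θ :=
      Metric.coveringNumber_anti (half_le_self (zero_le)|>.trans h)
    have h3 : (Metric.coveringNumber δ Θ).toNat ≤ (Metric.coveringNumber (ε / 2) Θ).toNat :=
      ENat.toNat_le_toNat h2 (coveringNumber_ne_top hΘ hε2.ne')
    have h4 : ((Metric.coveringNumber δ Θ).toNat : ℝ) ≤ N0 := Nat.cast_le.2 h3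
    nlinarith

end Minkowski

/-! ### Fourier inversion in $L^2$ and Sobolev weights. -/

section FourierFacts

open scoped SchwartzMap ContDiff

theorem integral_schwartz_fourierInv_mul (φ : 𝓢(ℝ, ℂ)) {G : ℝ → ℂ} (hG : Integrable G) :
    ∫ ξ, 𝓕⁻ φ ξ • G ξ = ∫ x, φ x • 𝓕⁻ G x := by
  have h := VectorFourier.integral_fourierIntegral_smul_eq_flip (L := -innerₗ ℝ) (μ := volume)
    (ν := volume) Real.continuous_fourierChar (by simp only [LinearMap.neg_apply, innerₗ_apply_apply]; fun_prop)
    φ.integrable hG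
  have e : (-innerₗ ℝ).flip = -innerₗ ℝ := by
    ext; simp
  rw [e] at h
  rw [SchwartzMap.fourierInv_coe]
  exact h

theorem locallyIntegrable_fourierInv {G : ℝ → ℂ} (hG : Integrable G) :
    LocallyIntegrable (𝓕⁻ G : ℝ → ℂ) := by
  apply Continuous.locallyIntegrable
  rw [Real.fourierInv_eq_fourier_comp_neg]
  exact VectorFourier.fourierIntegral_continuous Real.continuous_fourierChar
    (by fun_prop) hG.comp_neg

/-- On `L¹ ∩ L²` the inverse Fourier transform of `L²` is given by the integral. -/
theorem coeFn_fourierInv_toLp_ae_eq {G : ℝ → ℂ} (hG : Integrable G) (hG2 : MemLp G 2) :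
    (𝓕⁻ (hG2.toLp G) : Lp ℂ 2 (volume : Measure ℝ)) =ᵐ[volume] (𝓕⁻ G : ℝ → ℂ) := by
  refine ae_eq_of_integral_contDiff_smul_eq
    ((Lp.memLp (𝓕⁻ (hG2.toLp G) : Lp ℂ 2 (volume : Measure ℝ))).locallyIntegrable (by norm_num))
    (locallyIntegrable_fourierInv hG) fun g g_smooth g_cpt => ?_
  have hg₁ : HasCompactSupport (Complex.ofRealCLM ∘ g) := g_cpt.comp_left rfl
  have hg₂ : ContDiff ℝ ∞ (Complex.ofRealCLM ∘ g) := by fun_prop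
  set φ : 𝓢(ℝ, ℂ) := hg₁.toSchwartzMap hg₂ with hφ
  have h1 : Lp.toTemperedDistribution (𝓕⁻ (hG2.toLp G) : Lp ℂ 2 (volume : Measure ℝ)) φ =
      Lp.toTemperedDistribution (hG2.toLp G) (𝓕⁻ φ) := by
    rw [← Lp.fourierInv_toTemperedDistribution_eq, TemperedDistribution.fourierInv_apply]
  rw [Lp.toTemperedDistribution_apply, Lp.toTemperedDistribution_apply] at h1
  have h2 : ∫ ξ, 𝓕⁻ φ ξ • (hG2.toLp G) ξ = ∫ ξ, 𝓕⁻ φ ξ • G ξ := by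
    apply integral_congr_ae
    filter_upwards [hG2.coeFn_toLp] with ξ hξ
    rw [hξ]
  rw [h2, integral_schwartz_fourierInv_mul φ hG] at h1
  simpa [hφ] using h1

theorem integrable_indicator_of_memLp_two {F : ℝ → ℂ} (hF : MemLp F 2) (K : ℝ) :
    Integrable ((Set.Icc (-K) K).indicator F) := by
  rw [integrable_indicator_iff measurableSet_Icc]
  exact (hF.restrict (Set.Icc (-K) K)).integrable (by norm_num)

theorem truncatedEvolution_zero (m : ℝ) (f : Lp ℂ 2 (volume : Measure ℝ)) (K x : ℝ) :
    truncatedEvolution m f K x 0 =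
      𝓕⁻ ((Set.Icc (-K) K).indicator (𝓕 f : Lp ℂ 2 (volume : Measure ℝ)) : ℝ → ℂ) x := by
  rw [Real.fourierInv_eq', truncatedEvolution, ← integral_indicator measurableSet_Icc]
  congr 1; ext ξ
  by_cases h : ξ ∈ Set.Icc (-K) K
  · rw [Set.indicator_of_mem h, Set.indicator_of_mem h, smul_eq_mul]
    congr 2
    simp
    ring
  · rw [Set.indicator_of_notMem h, Set.indicator_of_notMem h, smul_zero]

theorem tendsto_toLp_indicator (F : Lp ℂ 2 (volume : Measure ℝ)) :
    Tendsto (fun n : ℕ => ((Lp.memLp F).indicator (measurableSet_Icc (a := -(n : ℝ)) (b := n))).toLp)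
      atTop (𝓝 F) := by
  rw [Lp.tendsto_Lp_iff_tendsto_eLpNorm']
  have h : Tendsto (fun n : ℕ => ∫⁻ x, ‖(Set.Icc (-(n : ℝ)) n).indicator F x - F x‖ₑ ^ (2 : ℝ)) atTop
      (𝓝 0) := by
    rw [← lintegral_zero (μ := (volume : Measure ℝ))]
    refine tendsto_lintegral_of_dominated_convergence' (fun x => ‖F x‖ₑ ^ (2 : ℝ)) (fun n => ?_)
      (fun n => Eventually.of_forall fun x => ?_) ?_ (Eventually.of_forall fun x => ?_)
    · exact (((Lp.aestronglyMeasurable F).indicator measurableSet_Icc).sub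
        (Lp.aestronglyMeasurable F)).enorm.pow_const _
    · by_cases hx : x ∈ Set.Icc (-(n : ℝ)) n
      · simp [hx]
      · simp [hx]
    · exact (lintegral_rpow_enorm_lt_top_of_eLpNorm_lt_top (by norm_num) (by norm_num)
        (Lp.memLp F).2).ne
    · obtain ⟨N, hN⟩ := exists_nat_ge |x|
      refine tendsto_const_nhds.congr' ?_
      filter_upwards [eventually_ge_atTop N] with n hn
      have : |x| ≤ n := hN.trans (by exact_mod_cast hn)
      have hx : x ∈ Set.Icc (-(n : ℝ)) n := abs_le.1 this
      simp [hx]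
  have h2 := h.ennrpow_const (1 / 2)
  rw [ENNReal.zero_rpow_of_pos (by norm_num)] at h2
  refine h2.congr fun n => ?_
  rw [eLpNorm_eq_lintegral_rpow_enorm_toReal (by norm_num) (by norm_num)]
  simp only [ENNReal.toReal_ofNat]
  congr 1
  apply lintegral_congr_ae
  filter_upwards [((Lp.memLp F).indicator (measurableSet_Icc (a := -(n : ℝ)) (b := n))).coeFn_toLp]
    with x hx
  simp [hx]

/-- If the truncated Fourier integrals at time zero converge a.e., the limit is the function. -/
theorem ae_eq_of_tendsto_truncatedEvolution (m : ℝ) (f : Lp ℂ 2 (volume : Measure ℝ)) :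
    ∀ᵐ x : ℝ, ∀ z : ℂ, Tendsto (fun R : ℝ => truncatedEvolution m f R x 0) atTop (𝓝 z) →
      z = f x := by
  set F : Lp ℂ 2 (volume : Measure ℝ) := 𝓕 f with hF
  have hcv : Tendsto (fun n : ℕ => (𝓕⁻ (((Lp.memLp F).indicator
      (measurableSet_Icc (a := -(n : ℝ)) (b := n))).toLp) : Lp ℂ 2 (volume : Measure ℝ)))
      atTop (𝓝 f) := by
    have h := ((Lp.fourierTransformₗᵢ ℝ ℂ).symm.continuous.tendsto F).comp (tendsto_toLp_indicator F)
    have e : (Lp.fourierTransformₗᵢ ℝ ℂ).symm F = f := (Lp.fourierTransformₗᵢ ℝ ℂ).symm_apply_apply f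
    rw [e] at h
    exact h
  -- An a.e. convergent subsequence is enough, since the full limit is assumed to exist at the
  -- point.
  obtain ⟨ns, hns, hae⟩ := (tendstoInMeasure_of_tendsto_Lp hcv).exists_seq_tendsto_ae
  have hall : ∀ᵐ x : ℝ, ∀ n : ℕ, (𝓕⁻ (((Lp.memLp F).indicator
      (measurableSet_Icc (a := -(n : ℝ)) (b := n))).toLp) : Lp ℂ 2 (volume : Measure ℝ)) x =
      truncatedEvolution m f n x 0 := by
    rw [ae_all_iff]
    intro n
    filter_upwards [coeFn_fourierInv_toLp_ae_eq (integrable_indicator_of_memLp_two (Lp.memLp F) n)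
      ((Lp.memLp F).indicator (measurableSet_Icc (a := -(n : ℝ)) (b := n)))] with x hx
    rw [hx, truncatedEvolution_zero]
  filter_upwards [hae, hall] with x hx hx' z hz
  have h1 : Tendsto (fun i => truncatedEvolution m f (ns i : ℝ) x 0) atTop (𝓝 z) :=
    hz.comp (tendsto_natCast_atTop_atTop.comp hns.tendsto_atTop)
  refine tendsto_nhds_unique h1 (hx.congr fun i => hx' (ns i))

/-- The Sobolev condition is distributional. Multiplying by the inverse weight, bounded as $s\ge0$,
stays in $L^2$, and $L^2$ functions are determined by their distributions. -/
theorem exists_lp_of_inSobolev {s : ℝ} (hs : 0 ≤ s) {f : Lp ℂ 2 (volume : Measure ℝ)}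
    (hf : InSobolev s f) : ∃ G : Lp ℂ 2 (volume : Measure ℝ),
      ∀ᵐ ξ : ℝ, (𝓕 f : Lp ℂ 2 (volume : Measure ℝ)) ξ =
        (((1 + ‖ξ‖ ^ 2) ^ (-s / 2) : ℝ) : ℂ) * G ξ := by
  obtain ⟨G, hG⟩ := TemperedDistribution.memSobolev_iff_exists_smulLeftCLM_fourier.1 hf
  rw [Lp.fourier_toTemperedDistribution_eq] at hG
  set w : ℝ → ℂ := fun ξ => (((1 + ‖ξ‖ ^ 2) ^ (-s / 2) : ℝ) : ℂ) with hw
  have hwt : w.HasTemperateGrowth := by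
    rw [hw]; fun_prop
  have hwb : MemLp w ⊤ volume := by
    refine memLp_top_of_bound hwt.1.continuous.aestronglyMeasurable 1 (Eventually.of_forall fun ξ => ?_)
    rw [hw, Complex.norm_real, Real.norm_of_nonneg (by positivity)]
    exact Real.rpow_le_one_of_one_le_of_nonpos (by simp [sq_nonneg]) (by linarith)
  refine ⟨G, ?_⟩
  have h1 := Lp.toTemperedDistribution_smul_eq (r := 2) hwt hwb G
  rw [← hG, TemperedDistribution.smulLeftCLM_smulLeftCLM_apply (by fun_prop) hwt] at h1
  have e : ((fun ξ : ℝ => (((1 + ‖ξ‖ ^ 2) ^ (s / 2) : ℝ) : ℂ)) * w) = fun _ => 1 := by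
    ext ξ
    simp only [hw, Pi.mul_apply]
    norm_cast
    rw [← Real.rpow_add (by positivity)]
    ring_nf
    simp
  rw [e, TemperedDistribution.smulLeftCLM_const, one_smul] at h1
  have h2 : hwb.toLp • G = (𝓕 f : Lp ℂ 2 (volume : Measure ℝ)) :=
    LinearMap.ker_eq_bot.1 (Lp.ker_toTemperedDistributionCLM_eq_bot (F := ℂ) (μ := volume) (p := 2)) h1
  rw [← h2]
  filter_upwards [Lp.coeFn_lpSMul (r := 2) hwb.toLp G, hwb.coeFn_toLp] with ξ h3 h4
  rw [h3, Pi.smul_apply', h4, smul_eq_mul]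

theorem setIntegral_shell_le {s lam : ℝ} (hs : 0 ≤ s) (hlam : 0 < lam) {F G : ℝ → ℂ}
    (hG : MemLp G 2) (h : ∀ᵐ ξ : ℝ, F ξ = (((1 + ‖ξ‖ ^ 2) ^ (-s / 2) : ℝ) : ℂ) * G ξ) :
    ∫ ξ in shell lam, ‖F ξ‖ ^ 2 ≤ lam ^ (-(2 * s)) * ∫ ξ, ‖G ξ‖ ^ 2 := by
  have iG : Integrable fun ξ => ‖G ξ‖ ^ 2 := hG.integrable_norm_pow (by norm_num)
  calc ∫ ξ in shell lam, ‖F ξ‖ ^ 2 ≤ ∫ ξ in shell lam, lam ^ (-(2 * s)) * ‖G ξ‖ ^ 2 := by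
        refine integral_mono_of_nonneg (Eventually.of_forall fun _ => by positivity)
          (iG.integrableOn.const_mul _) ?_
        filter_upwards [ae_restrict_of_ae h, ae_restrict_mem (measurableSet_shell lam)] with ξ hξ hξ'
        rw [hξ, norm_mul, mul_pow, Complex.norm_real, Real.norm_of_nonneg (by positivity)]
        gcongr
        rw [← Real.rpow_natCast, ← Real.rpow_mul (by positivity)]
        calc (1 + ‖ξ‖ ^ 2) ^ (-s / 2 * (2 : ℕ)) ≤ (lam ^ 2) ^ (-s / 2 * (2 : ℕ)) := by
              refine Real.rpow_le_rpow_of_nonpos (by positivity) ?_ (by push_cast; linarith)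
              have : lam ≤ ‖ξ‖ := hξ'.1.le
              nlinarith
          _ = _ := by
              rw [← Real.rpow_natCast, ← Real.rpow_mul hlam.le]
              congr 1; push_cast; ring
    _ = lam ^ (-(2 * s)) * ∫ ξ in shell lam, ‖G ξ‖ ^ 2 := integral_const_mul _ _
    _ ≤ _ := by
        refine mul_le_mul_of_nonneg_left ?_ (by positivity)
        exact setIntegral_le_integral iG (Eventually.of_forall fun _ => by positivity)

end FourierFacts

/-! ### Continuity of the frequency pieces in their parameters. -/

section Continuity

/-- Continuity holds even in the cutoff, because the sharp truncation jumps only at $\xi=\pm R$, a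
null set. This lets a countable dense set of parameters control all of them. -/
theorem continuous_setIntegral_lineWave {m : ℝ} (hm : 0 < m) {S : Set ℝ}
    {F : ℝ → ℂ} (hF : IntegrableOn F S) (x : ℝ) :
    Continuous fun p : ℝ × ℝ × ℝ => ∫ ξ in S, lineWave m p x ξ * F ξ := by
  rw [continuous_iff_continuousAt]
  intro p
  refine continuousAt_of_dominated (bound := fun ξ => ‖F ξ‖) (Eventually.of_forall fun q => ?_)
    (Eventually.of_forall fun q => Eventually.of_forall fun ξ => ?_) hF.norm ?_
  · exact (((measurable_lineWave hm q).comp measurable_prodMk_left).aestronglyMeasurable).mul hF.1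
  · rw [norm_mul]
    exact mul_le_of_le_one_left (norm_nonneg _) (norm_lineWave_le _ _ _ _)
  · have hne : ∀ᵐ ξ : ℝ, ξ ∉ ({p.2.2, -p.2.2} : Set ℝ) :=
      measure_eq_zero_iff_ae_notMem.1 ((Set.toFinite _).measure_zero _)
    filter_upwards [ae_restrict_of_ae hne] with ξ hξ
    refine ContinuousAt.mul ?_ continuousAt_const
    have hne' : |ξ| ≠ p.2.2 := fun h => hξ (by
      rcases abs_choice ξ with h' | h'
      · left; linarith
      · right; rw [Set.mem_singleton_iff]; linarith)
    have hc : Continuous fun q : ℝ × ℝ × ℝ => wave m (x - q.1 * q.2.1) q.2.1 ξ :=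
      (continuous_wave hm).comp
        (by fun_prop : Continuous fun q : ℝ × ℝ × ℝ => (x - q.1 * q.2.1, q.2.1, ξ))
    have hc2 : ContinuousAt (fun q : ℝ × ℝ × ℝ => q.2.2) p := by fun_prop
    rcases lt_or_gt_of_ne hne' with h | h
    · refine hc.continuousAt.congr ?_
      filter_upwards [hc2.eventually (lt_mem_nhds h)] with q hq
      rw [lineWave, if_pos hq.le]
    · refine (continuousAt_const (y := (0 : ℂ))).congr ?_
      filter_upwards [hc2.eventually (gt_mem_nhds h)] with q hq
      rw [lineWave, if_neg (not_le.2 hq)]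

theorem continuous_setIntegral_wave {m : ℝ} (hm : 0 < m) {S : Set ℝ} {F : ℝ → ℂ}
    (hF : IntegrableOn F S) :
    Continuous fun p : ℝ × ℝ => ∫ ξ in S, wave m p.1 p.2 ξ * F ξ := by
  refine continuous_of_dominated (bound := fun ξ => ‖F ξ‖) (fun q => ?_)
    (fun q => Eventually.of_forall fun ξ => ?_) hF.norm (Eventually.of_forall fun ξ => ?_)
  · exact ((continuous_wave hm).comp
      (by fun_prop : Continuous fun ξ : ℝ => (q.1, q.2, ξ))).aestronglyMeasurable.mul hF.1
  · rw [norm_mul, norm_wave, one_mul]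
  · exact ((continuous_wave hm).comp
      (by fun_prop : Continuous fun p : ℝ × ℝ => (p.1, p.2, ξ))).mul continuous_const

end Continuity

/-! ### Dyadic decomposition of the evolution. -/

section Frequencies

/-- The unit interval followed by the dyadic shells. -/
def freqPiece : ℕ → Set ℝ
  | 0 => Set.Icc (-1) 1
  | j + 1 => shell (2 ^ j)

theorem measurableSet_freqPiece (n : ℕ) : MeasurableSet (freqPiece n) := by
  cases n with
  | zero => exact measurableSet_Icc
  | succ j => exact measurableSet_shell _

theorem abs_le_of_mem_freqPiece {n : ℕ} {ξ : ℝ} (h : ξ ∈ freqPiece n) : |ξ| ≤ 2 ^ n := by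
  cases n with
  | zero => simpa using abs_le.2 h
  | succ j => rw [pow_succ, mul_comm]; exact h.2

theorem lt_abs_of_mem_freqPiece_succ {j : ℕ} {ξ : ℝ} (h : ξ ∈ freqPiece (j + 1)) : 2 ^ j < |ξ| := h.1

theorem volume_freqPiece_lt_top (n : ℕ) : volume (freqPiece n) < ⊤ := by
  cases n with
  | zero => simp [freqPiece]
  | succ j => exact volume_shell_lt_top _

theorem pairwise_disjoint_freqPiece : Pairwise (Function.onFun Disjoint freqPiece) := by
  have key : ∀ a b : ℕ, a < b → Disjoint (freqPiece a) (freqPiece b) := by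
    intro a b hab
    obtain ⟨c, rfl⟩ := Nat.exists_eq_succ_of_ne_zero (Nat.ne_zero_of_lt hab)
    rw [Set.disjoint_left]
    intro ξ h1 h2
    have h3 := abs_le_of_mem_freqPiece h1
    have h4 := lt_abs_of_mem_freqPiece_succ h2
    have h5 : (2 : ℝ) ^ a ≤ 2 ^ c := pow_le_pow_right₀ (by norm_num) (Nat.lt_succ_iff.1 hab)
    linarith
  intro a b hab
  rcases lt_or_gt_of_ne hab with h | h
  · exact key a b h
  · exact (key b a h).symm

theorem iUnion_freqPiece : ⋃ n, freqPiece n = Set.univ := by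
  refine Set.eq_univ_of_forall fun ξ => Set.mem_iUnion.2 ?_
  have hex : ∃ n : ℕ, |ξ| ≤ 2 ^ n := by
    obtain ⟨n, hn⟩ := pow_unbounded_of_one_lt |ξ| (by norm_num : (1 : ℝ) < 2)
    exact ⟨n, hn.le⟩
  classical
  refine ⟨Nat.find hex, ?_⟩
  have h1 := Nat.find_spec hex
  have h2 := fun j => Nat.find_min hex (m := j)
  generalize Nat.find hex = n at h1 h2
  cases n with
  | zero => exact abs_le.1 (by simpa using h1)
  | succ j => exact ⟨not_le.1 (h2 j (Nat.lt_succ_self j)), by rwa [pow_succ, mul_comm] at h1⟩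

theorem hasSum_truncatedEvolution {m : ℝ} (hm : 0 < m) (f : Lp ℂ 2 (volume : Measure ℝ))
    (x θ t R : ℝ) :
    HasSum (fun n => ∫ ξ in freqPiece n, lineWave m (θ, t, R) x ξ *
      (𝓕 f : Lp ℂ 2 (volume : Measure ℝ)) ξ) (truncatedEvolution m f R (x - θ * t) t) := by
  set F : Lp ℂ 2 (volume : Measure ℝ) := 𝓕 f
  have e : ∀ ξ, lineWave m (θ, t, R) x ξ * F ξ =
      (Set.Icc (-R) R).indicator (fun ξ => wave m (x - θ * t) t ξ * F ξ) ξ := fun ξ => by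
    by_cases h : ξ ∈ Set.Icc (-R) R
    · rw [Set.indicator_of_mem h, lineWave, if_pos (abs_le.2 h)]
    · rw [Set.indicator_of_notMem h, lineWave, if_neg fun h' => h (abs_le.1 h'), zero_mul]
  have hint : Integrable fun ξ => lineWave m (θ, t, R) x ξ * F ξ := by
    simp_rw [e]
    rw [integrable_indicator_iff measurableSet_Icc]
    refine Integrable.bdd_mul (c := 1) (((Lp.memLp F).restrict _).integrable (by norm_num)) ?_
      (Eventually.of_forall fun ξ => (norm_wave _ _ _ _).le)
    exact ((continuous_wave hm).comp
      (by fun_prop : Continuous fun ξ : ℝ => (x - θ * t, t, ξ))).aestronglyMeasurable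
  have h := hasSum_integral_iUnion measurableSet_freqPiece pairwise_disjoint_freqPiece
    hint.integrableOn
  rw [iUnion_freqPiece, setIntegral_univ] at h
  rw [integral_congr_ae (Eventually.of_forall e), integral_indicator measurableSet_Icc] at h
  exact h

end Frequencies

/-! ### Summability of the dyadic maximal functions. -/

section Maximal

/-- The pairs (line through `x` with slope in `Θ`, time in `[-1, 1]`) with a frequency cutoff. -/
def lineParams (Θ : Set ℝ) : Set (ℝ × ℝ × ℝ) := {p | p.1 ∈ Θ ∧ |p.2.1| ≤ 1}

/-- `L¹` bound, on bounded sets, for the maximal functions of the dyadic pieces, with geometric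
decay. -/
theorem exists_lintegral_maximal_le {m : ℝ} (hm0 : 0 < m) (hm1 : m < 1) {Θ : Set ℝ}
    (hΘ : IsCompact Θ) (hne : Θ.Nonempty) {s : ℝ}
    (hs : 1 / 2 - m / 4 + m * minkowskiDim Θ / 4 < s) {f : Lp ℂ 2 (volume : Measure ℝ)}
    (hf : InSobolev s f) (q : ℕ → ℝ × ℝ × ℝ) (hq : ∀ n, q n ∈ lineParams Θ) {k : ℝ} (hk : 0 ≤ k) :
    ∃ C r : ℝ, 0 ≤ C ∧ 0 < r ∧ r < 1 ∧ ∀ j : ℕ,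
      ∫⁻ x in Set.Icc (-k) k, ⨆ n, ‖∫ ξ in shell (2 ^ j), lineWave m (q n) x ξ *
        (𝓕 f : Lp ℂ 2 (volume : Measure ℝ)) ξ‖ₑ ≤ ENNReal.ofReal (C * r ^ j) := by
  have hβ0 := minkowskiDim_nonneg hΘ hne
  have hs0 : 0 ≤ s := by
    have : 0 ≤ m * minkowskiDim Θ := by positivity
    linarith
  obtain ⟨β, hβ1, hβ2⟩ : ∃ β, minkowskiDim Θ < β ∧ 1 / 2 - m / 4 + m * β / 4 < s := by
    -- Raising the dimension by the whole gap costs only $m/4<1$ of that gap.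
    refine ⟨minkowskiDim Θ + (s - (1 / 2 - m / 4 + m * minkowskiDim Θ / 4)) , by linarith, ?_⟩
    nlinarith
  set ε := s - (1 / 2 - m / 4 + m * β / 4) with hε
  have hε0 : 0 < ε := by linarith
  obtain ⟨A, hA⟩ := hΘ.isBounded.exists_norm_le
  have hA0 : 0 ≤ A := (norm_nonneg _).trans (hA _ hne.some_mem)
  obtain ⟨C1, hC1, hcov⟩ := exists_coveringNumber_le_rpow hΘ hne hβ1
  obtain ⟨C2, hC2, hmax⟩ := exists_shell_maximal_bound_of_cover hm0 hm1 hA0 k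
  obtain ⟨G, hG⟩ := exists_lp_of_inSobolev hs0 hf
  set F : Lp ℂ 2 (volume : Measure ℝ) := 𝓕 f
  set g := ∫ ξ, ‖G ξ‖ ^ 2 with hg
  have hg0 : 0 ≤ g := integral_nonneg fun _ => by positivity
  set r : ℝ := 2 ^ (-ε) with hr
  have hr0 : 0 < r := by positivity
  refine ⟨2 * k + C2 * C1 * g, r, by positivity, hr0,
    Real.rpow_lt_one_of_one_lt_of_neg (by norm_num) (by linarith), fun j => ?_⟩
  set lam : ℝ := 2 ^ j with hlam
  have hlam1 : 1 ≤ lam := one_le_pow₀ (by norm_num)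
  have hlam0 : 0 < lam := by linarith
  have hrj : r ^ j = lam ^ (-ε) := by
    rw [hr, hlam, ← Real.rpow_natCast, ← Real.rpow_natCast, ← Real.rpow_mul (by norm_num),
      ← Real.rpow_mul (by norm_num), mul_comm]
  have hrj0 : 0 < r ^ j := by positivity
  -- the `L²` bound
  have hL2 : ∫⁻ x in Set.Icc (-k) k, ⨆ n, ‖∫ ξ in shell lam, lineWave m (q n) x ξ * F ξ‖ₑ ^ 2 ≤
      ENNReal.ofReal (C2 * C1 * g * (r ^ j) ^ 2) := by
    obtain ⟨δ, hδ⟩ : ∃ δ : ℝ≥0, (δ : ℝ) = lam ^ (-(m / 2)) :=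
      ⟨Real.toNNReal _, Real.coe_toNNReal _ (by positivity)⟩
    have hδ0 : 0 < δ := by
      rw [← NNReal.coe_pos, hδ]; exact Real.rpow_pos_of_pos hlam0 _
    have hδ1 : δ ≤ 1 := by
      rw [← NNReal.coe_le_coe, hδ]
      exact Real.rpow_le_one_of_one_le_of_nonpos hlam1 (by linarith)
    obtain ⟨N, hNcard, hN⟩ := exists_finset_cover hΘ hδ0.ne'
    refine (hmax lam hlam1 q (fun n => ⟨hA _ (hq n).1, (hq n).2⟩) N
      (fun n => hδ ▸ hN _ (hq n).1) F
      (Lp.stronglyMeasurable F).measurable ((Lp.memLp F).restrict _)).trans ?_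
    apply ENNReal.ofReal_le_ofReal
    have h1 : (N.card : ℝ) ≤ C1 * lam ^ (m * β / 2) := by
      rw [hNcard]
      refine (hcov δ hδ0 hδ1).trans (le_of_eq ?_)
      rw [hδ, ← Real.rpow_mul hlam0.le]
      congr 2; ring
    have h2 := setIntegral_shell_le hs0 hlam0 (Lp.memLp G) hG
    calc C2 * (N.card * lam ^ (1 - m / 2)) * ∫ ξ in shell lam, ‖F ξ‖ ^ 2
        ≤ C2 * (C1 * lam ^ (m * β / 2) * lam ^ (1 - m / 2)) * (lam ^ (-(2 * s)) * g) := by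
          gcongr
      _ = C2 * C1 * g * (lam ^ (m * β / 2) * lam ^ (1 - m / 2) * lam ^ (-(2 * s))) := by ring
      _ = _ := by
          rw [← Real.rpow_add hlam0, ← Real.rpow_add hlam0, hrj, ← Real.rpow_mul_natCast hlam0.le]
          congr 2
          rw [hε]; push_cast; ring
  -- pass to `L¹`
  set c : ENNReal := ENNReal.ofReal (r ^ j) with hc
  have hc0 : c ≠ 0 := by simpa [hc] using hrj0
  have hct : c ≠ ⊤ := ENNReal.ofReal_ne_top
  -- With $c=r^j$ and an $L^2$ bound of order $r^{2j}$, both terms integrate to $O(r^j)$ on a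
  -- bounded interval.
  have hpt : ∀ a : ENNReal, a ≤ c + c⁻¹ * a ^ 2 := fun a => by
    rcases le_total a c with h | h
    · exact h.trans le_self_add
    · calc a = c⁻¹ * c * a := by rw [ENNReal.inv_mul_cancel hc0 hct, one_mul]
        _ ≤ c⁻¹ * a * a := by gcongr
        _ = c⁻¹ * a ^ 2 := by ring
        _ ≤ _ := le_add_self
  calc _ ≤ ∫⁻ x in Set.Icc (-k) k, (c + c⁻¹ * ⨆ n, ‖∫ ξ in shell lam, lineWave m (q n) x ξ * F ξ‖ₑ ^ 2) := by
        refine lintegral_mono fun x => iSup_le fun n => (hpt _).trans ?_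
        gcongr
        exact le_iSup (fun n => ‖∫ ξ in shell lam, lineWave m (q n) x ξ * F ξ‖ₑ ^ 2) n
    _ = c * volume (Set.Icc (-k) k) +
        c⁻¹ * ∫⁻ x in Set.Icc (-k) k, ⨆ n, ‖∫ ξ in shell lam, lineWave m (q n) x ξ * F ξ‖ₑ ^ 2 := by
        rw [lintegral_add_left measurable_const, lintegral_const_mul' _ _ (ENNReal.inv_ne_top.2 hc0)]
        simp
    _ ≤ ENNReal.ofReal (r ^ j) * ENNReal.ofReal (2 * k) +
        ENNReal.ofReal ((r ^ j)⁻¹) * ENNReal.ofReal (C2 * C1 * g * (r ^ j) ^ 2) := by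
        rw [hc, ENNReal.ofReal_inv_of_pos hrj0, Real.volume_Icc]
        gcongr
        · linarith
    _ = _ := by
        rw [← ENNReal.ofReal_mul hrj0.le, ← ENNReal.ofReal_mul (by positivity),
          ← ENNReal.ofReal_add (by positivity) (by positivity)]
        congr 1
        field_simp

theorem ae_summable_maximal {m : ℝ} (hm0 : 0 < m) (hm1 : m < 1) {Θ : Set ℝ}
    (hΘ : IsCompact Θ) (hne : Θ.Nonempty) {s : ℝ}
    (hs : 1 / 2 - m / 4 + m * minkowskiDim Θ / 4 < s) {f : Lp ℂ 2 (volume : Measure ℝ)}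
    (hf : InSobolev s f) (q : ℕ → ℝ × ℝ × ℝ) (hq : ∀ n, q n ∈ lineParams Θ) :
    ∀ᵐ x : ℝ, ∑' j : ℕ, (⨆ n, ‖∫ ξ in shell (2 ^ j), lineWave m (q n) x ξ *
        (𝓕 f : Lp ℂ 2 (volume : Measure ℝ)) ξ‖ₑ) ≠ ⊤ := by
  set F : Lp ℂ 2 (volume : Measure ℝ) := 𝓕 f with hF
  set M : ℕ → ℝ → ENNReal := fun j x => ⨆ n, ‖∫ ξ in shell (2 ^ j), lineWave m (q n) x ξ * F ξ‖ₑ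
  have mM : ∀ j, Measurable (M j) := fun j => by
    refine Measurable.iSup fun n => ?_
    have : Measurable (Function.uncurry fun x ξ => lineWave m (q n) x ξ * F ξ) :=
      (measurable_lineWave hm0 _).mul ((Lp.stronglyMeasurable F).measurable.comp measurable_snd)
    exact (this.stronglyMeasurable.integral_prod_right'.measurable).enorm
  have hk : ∀ k : ℕ, ∀ᵐ x : ℝ, x ∈ Set.Icc (-(k : ℝ)) k → ∑' j, M j x ≠ ⊤ := fun k => by
    obtain ⟨C, r, hC, hr0, hr1, h⟩ :=
      exists_lintegral_maximal_le hm0 hm1 hΘ hne hs hf q hq (Nat.cast_nonneg k)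
    rw [← ae_restrict_iff' measurableSet_Icc]
    have hfin : ∫⁻ x in Set.Icc (-(k : ℝ)) k, ∑' j, M j x ≠ ⊤ := by
      rw [lintegral_tsum fun j => (mM j).aemeasurable]
      refine ne_top_of_le_ne_top ?_ (ENNReal.tsum_le_tsum h)
      rw [← ENNReal.ofReal_tsum_of_nonneg (fun j => by positivity)
        ((summable_geometric_of_lt_one hr0.le hr1).mul_left C)]
      exact ENNReal.ofReal_ne_top
    filter_upwards [ae_lt_top (Measurable.tsum mM) hfin] with x hx using hx.ne
  filter_upwards [ae_all_iff.2 hk] with x hx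
  obtain ⟨k, hk⟩ := exists_nat_ge |x|
  exact hx k (abs_le.1 hk)

/-- Almost everywhere, the dyadic pieces of the evolution on all the lines through `x` are
dominated by a summable sequence. -/
theorem ae_exists_summable_bound {m : ℝ} (hm0 : 0 < m) (hm1 : m < 1) {Θ : Set ℝ}
    (hΘ : IsCompact Θ) (hne : Θ.Nonempty) {s : ℝ}
    (hs : 1 / 2 - m / 4 + m * minkowskiDim Θ / 4 < s) {f : Lp ℂ 2 (volume : Measure ℝ)}
    (hf : InSobolev s f) :
    ∀ᵐ x : ℝ, ∃ B : ℕ → ℝ, Summable B ∧ ∀ p ∈ lineParams Θ, ∀ n,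
      ‖∫ ξ in freqPiece n, lineWave m p x ξ * (𝓕 f : Lp ℂ 2 (volume : Measure ℝ)) ξ‖ ≤ B n := by
  set F : Lp ℂ 2 (volume : Measure ℝ) := 𝓕 f with hF
  have hFi : ∀ n, IntegrableOn F (freqPiece n) := fun n => by
    have : IsFiniteMeasure (volume.restrict (freqPiece n)) :=
      ⟨by simpa using volume_freqPiece_lt_top n⟩
    exact ((Lp.memLp F).restrict _).integrable (by norm_num)
  have : Nonempty (lineParams Θ) := ⟨⟨(hne.some, 0, 0), hne.some_mem, by simp⟩⟩
  set q : ℕ → lineParams Θ := TopologicalSpace.denseSeq (lineParams Θ) with hq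
  filter_upwards [ae_summable_maximal hm0 hm1 hΘ hne hs hf (fun n => (q n : ℝ × ℝ × ℝ))
    (fun n => (q n).2)] with x hx
  set M : ℕ → ENNReal := fun j => ⨆ n, ‖∫ ξ in shell (2 ^ j), lineWave m (q n) x ξ * F ξ‖ₑ with hM
  have hMt : ∀ j, M j ≠ ⊤ := fun j => ENNReal.ne_top_of_tsum_ne_top hx j
  -- The low-frequency piece needs only the $L^1$ norm of $\widehat f$ on $[-1,1]$; index $j+1$
  -- belongs to the shell $2^j$.
  refine ⟨fun n => Nat.casesOn n (∫ ξ in freqPiece 0, ‖F ξ‖) fun j => (M j).toReal,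
    (summable_nat_add_iff 1).1 (ENNReal.summable_toReal hx), fun p hp n => ?_⟩
  cases n with
  | zero =>
    refine norm_integral_le_of_norm_le (hFi 0).norm (Eventually.of_forall fun ξ => ?_)
    rw [norm_mul]
    exact mul_le_of_le_one_left (norm_nonneg _) (norm_lineWave_le _ _ _ _)
  | succ j =>
    have hcl : IsClosed {p : lineParams Θ |
        ‖∫ ξ in freqPiece (j + 1), lineWave m p x ξ * F ξ‖ ≤ (M j).toReal} :=
      isClosed_le (((continuous_setIntegral_lineWave hm0 (hFi (j + 1)) x).comp
        continuous_subtype_val).norm) continuous_const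
    have hsub : Set.range q ⊆ {p : lineParams Θ |
        ‖∫ ξ in freqPiece (j + 1), lineWave m p x ξ * F ξ‖ ≤ (M j).toReal} := by
      rintro _ ⟨n, rfl⟩
      change ‖_‖ ≤ _
      rw [← toReal_enorm]
      exact ENNReal.toReal_mono (hMt j)
        (le_iSup (fun n => ‖∫ ξ in shell (2 ^ j), lineWave m (q n) x ξ * F ξ‖ₑ) n)
    have := (TopologicalSpace.denseRange_denseSeq (lineParams Θ)).closure_eq ▸ closure_minimal hsub hcl
    exact this (Set.mem_univ (⟨p, hp⟩ : lineParams Θ))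

end Maximal

/-! ### Pointwise convergence along the lines. -/

theorem theorem3 (m : ℝ) (hm0 : 0 < m) (hm1 : m < 1) (Θ : Set ℝ) (hΘ : IsCompact Θ)
    (s : ℝ) (hs : 1 / 2 - m / 4 + m * minkowskiDim Θ / 4 < s)
    (f : Lp ℂ 2 (volume : Measure ℝ)) (hf : InSobolev s f) :
    ∀ᵐ x : ℝ,
      (∀ᶠ p : ℝ × ℝ in 𝓝[linesThrough Θ x] (x, 0), EvolutionConverges m f p.1 p.2) ∧
      Tendsto (fun p : ℝ × ℝ => evolution m f p.1 p.2) (𝓝[linesThrough Θ x] (x, 0))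
        (𝓝 (f x)) := by
  -- Without lines the filter is trivial and both claims are vacuous.
  rcases Θ.eq_empty_or_nonempty with rfl | hne
  · have : ∀ x, linesThrough ∅ x = ∅ := fun x => by ext; simp [linesThrough]
    simp [this]
  filter_upwards [ae_exists_summable_bound hm0 hm1 hΘ hne hs hf,
    ae_eq_of_tendsto_truncatedEvolution m f] with x ⟨B, hB, hbd⟩ hfx
  set F : Lp ℂ 2 (volume : Measure ℝ) := 𝓕 f with hF
  have hFi : ∀ n, IntegrableOn F (freqPiece n) := fun n => by
    have : IsFiniteMeasure (volume.restrict (freqPiece n)) :=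
      ⟨by simpa using volume_freqPiece_lt_top n⟩
    exact ((Lp.memLp F).restrict _).integrable (by norm_num)
  set W : ℝ × ℝ → ℕ → ℂ := fun p n => ∫ ξ in freqPiece n, wave m p.1 p.2 ξ * F ξ with hW
  have hWU : ∀ θ t R : ℝ, ∀ n : ℕ, 2 ^ n ≤ R →
      ∫ ξ in freqPiece n, lineWave m (θ, t, R) x ξ * F ξ = W (x - θ * t, t) n := by
    intro θ t R n hR
    refine setIntegral_congr_fun (measurableSet_freqPiece n) fun ξ hξ => ?_
    simp only
    rw [lineWave, if_pos ((abs_le_of_mem_freqPiece hξ).trans hR)]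
  have hWB : ∀ θ ∈ Θ, ∀ t : ℝ, |t| ≤ 1 → ∀ n, ‖W (x - θ * t, t) n‖ ≤ B n := by
    intro θ hθ t ht n
    rw [← hWU θ t (2 ^ n) n le_rfl]
    exact hbd _ ⟨hθ, ht⟩ n
  have hconv : ∀ θ ∈ Θ, ∀ t : ℝ, |t| ≤ 1 →
      Tendsto (fun R => truncatedEvolution m f R (x - θ * t) t) atTop
        (𝓝 (∑' n, W (x - θ * t, t) n)) := by
    intro θ hθ t ht
    simp_rw [← (hasSum_truncatedEvolution hm0 f x θ t _).tsum_eq]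
    refine tendsto_tsum_of_dominated_convergence hB (fun n => ?_)
      (Eventually.of_forall fun R n => hbd _ ⟨hθ, ht⟩ n)
    refine tendsto_const_nhds.congr' ?_
    filter_upwards [eventually_ge_atTop (2 ^ n)] with R hR
    exact (hWU θ t R n hR).symm
  have hev : ∀ᶠ p : ℝ × ℝ in 𝓝[linesThrough Θ x] (x, 0),
      ∃ θ ∈ Θ, |p.2| ≤ 1 ∧ p = (x - θ * p.2, p.2) := by
    have h1 : ∀ᶠ p : ℝ × ℝ in 𝓝 (x, 0), |p.2| < 1 :=
      (continuous_snd.abs.tendsto (x, (0 : ℝ))).eventually (gt_mem_nhds (by simp))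
    filter_upwards [self_mem_nhdsWithin, mem_nhdsWithin_of_mem_nhds h1] with p ⟨θ, hθ, hp⟩ hp1
    exact ⟨θ, hθ, hp1.le, Prod.ext hp rfl⟩
  have hval : ∀ᶠ p : ℝ × ℝ in 𝓝[linesThrough Θ x] (x, 0), evolution m f p.1 p.2 = ∑' n, W p n := by
    filter_upwards [hev] with p ⟨θ, hθ, ht, hp⟩
    have h := (hconv θ hθ p.2 ht).limUnder_eq
    rw [← hp] at h
    have hp1 : p.1 = x - θ * p.2 := congrArg Prod.fst hp
    rw [evolution, hp1]
    exact h
  constructor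
  · filter_upwards [hev] with p ⟨θ, hθ, ht, hp⟩
    have hp1 : p.1 = x - θ * p.2 := congrArg Prod.fst hp
    rw [EvolutionConverges, hp1]
    exact ⟨_, hconv θ hθ p.2 ht⟩
  · obtain ⟨θ, hθ⟩ := hne
    -- Every line through $x$ contains $(x,0)$, so convergence there is a case of `hconv`, and its
    -- limit must be $f(x)$.
    have hlim : ∑' n, W (x, 0) n = f x := by
      apply hfx
      simpa using hconv θ hθ 0 (by simp)
    rw [← hlim]
    refine Tendsto.congr' (hval.mono fun p hp => hp.symm) ?_
    refine tendsto_tsum_of_dominated_convergence hB (fun n => ?_) ?_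
    · exact ((continuous_setIntegral_wave hm0 (hFi n)).tendsto (x, 0)).mono_left nhdsWithin_le_nhds
    · filter_upwards [hev] with p ⟨θ, hθ, ht, hp⟩ n
      rw [hp]
      exact hWB θ hθ p.2 ht n
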